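/- Let $A$ be a unital Banach $*$-algebra over $\mathbb C$, let $B\subseteq A$ be a closed unital $*$-subalgebra and let $E:A\to B$ be a bounded $B$-bimodule map with $E(b)=b$ for all $b\in B$. Let $\alpha,\beta:B\to B$ be $\mathbb C$-linear and let $z\in A$ be $B$-circular with covariance $(\alpha,\beta)$; that is, all $B$-valued free cumulants of the pair $(z,z^*)$ of order different from $2$ vanish, and $$E(z^*bz)=\alpha(b),\quad E(zbz^*)=\beta(b),\quad E(zbz)=E(z^*bz^*)=E(z)=E(z^*)=0\qquad(b\in B).$$ Here the $B$-valued free cumulants $\kappa_n$ are determined by the moment-cumulant formula $E(a_1\cdots a_n)=\sum_{\pi\in NC(n)}\pi\{a_1,\dots,a_n\}$ ($n\ge1$), the sum being over noncrossing partitions and $\pi\{\cdots\}$ denoting the nested evaluation of $\kappa$ along the blocks of $\pi$. For $x\in A$ and $b\in B$ put $\tilde G_x(b)=\sum_{n\ge0}E(b(xb)^n)$ whenever the series converges. (1) There is $\delta>0$ such that for all $b,c\in B$ with $\|b\|\,\|c\|<\delta$ the series $\tilde G_{z^*cz}(b)$ and $\tilde G_{zbz^*}(c)$ converge, the inverses below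 exist in $B$, and $$\tilde G_{z^*cz}(b)=\bigl(1-b\,\alpha(\tilde G_{zbz^*}(c))\bigr)^{-1}b=\Bigl(1-b\,\alpha\bigl((1-c\,\beta(\tilde G_{z^*cz}(b)))^{-1}c\bigr)\Bigr)^{-1}b .$$ (2) The $B$-valued R-transform of $z^*cz$ is $$R_{z^*cz}(b)=\alpha\bigl((1-c\,\beta(b))^{-1}c\bigr),$$ in both of the usual senses. First, after decreasing $\delta$ if necessary, for all $b,c\in B$ with $\|b\|\,\|c\|<\delta$ the element $1-c\,\beta(b)$ is invertible in $B$ and, with $x=z^*cz$, the series $\sum_{n\ge0}\kappa_{n+1}(xb,\dots,xb,x)$ (with $n$ arguments $xb$) converges to $\alpha((1-c\,\beta(b))^{-1}c)$. Secondly, for every $c\in B$, the map $R(b)=\alpha((1-c\,\beta(b))^{-1}c)$ is analytic at $0$ and there is a map $K$ from $B$ to $B$, analytic at $0$ with $K(0)=0$, such that $\tilde G_{z^*cz}(K(b))=b=K(\tilde G_{z^*cz}(b))$ for all $b$ near $0$, and such that for all invertible $b\in B$ near $0$ the element $K(b)$ is invertible and $R(b)+b^{-1}=K(b)^{-1}$.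 -/

import Mathlib

open Filter Topology

noncomputable section

namespace BFree

section Algebraic

variable {A : Type*} [Ring A] [StarRing A] [Algebra ℂ A] [StarModule ℂ A]

/-- `(A, E)` is a `B`-valued *-noncommutative probability space: `B` is a unital *-subalgebra
of `A` and `E : A → B` is a `B`-bimodule map which restricts to the identity on `B`. -/
structure IsNCProbSpace (B : StarSubalgebra ℂ A) (E : A →ₗ[ℂ] B) : Prop where
  map_mul_left : ∀ (b : B) (a : A), E ((b : A) * a) = b * E a
  map_mul_right : ∀ (a : A) (b : B), E (a * (b : A)) = E a * b
  map_coe : ∀ b : B, E (b : A) = b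

/-- A partition of `{0, …, n - 1}` is noncrossing if there are no `i < j < k < m` with
`i, k` in one block and `j, m` in another block. -/
def IsNoncrossing {n : ℕ} (π : Finpartition (Finset.range n)) : Prop :=
  ∀ P ∈ π.parts, ∀ Q ∈ π.parts, ∀ i ∈ P, ∀ k ∈ P, ∀ j ∈ Q, ∀ m ∈ Q,
    i < j → j < k → k < m → P = Q

open Classical in
/-- The set `NC(n)` of noncrossing partitions of `{0, …, n - 1}`. -/
def NC (n : ℕ) : Finset (Finpartition (Finset.range n)) :=
  Finset.univ.filter IsNoncrossing

/-- The smallest element of `V` that is larger than `i`, or `r` if `V` has no element in the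
open interval `(i, r)`. -/
def nextOr (V : Finset ℕ) (i r : ℕ) : ℕ :=
  (insert r (V.filter fun j => i < j)).min' (Finset.insert_nonempty _ _)

theorem nextOr_le (V : Finset ℕ) (i r : ℕ) : nextOr V i r ≤ r :=
  Finset.min'_le _ _ (Finset.mem_insert_self _ _)

/-- The nested evaluation of a partition on the letters `a l, …, a (r - 1)`, for a family `κ` of
`B`-valued functions of finite lists (`κ [x₁, …, xₖ]` being the value of a block of size `k`);
`blk i` is the block of `i`.  If `l = i₁ < i₂ < ⋯ < iₖ` is the block of the first letter and
`gⱼ ∈ B` is the nested evaluation on the letters strictly between positions `iⱼ` and `iⱼ₊₁`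
(where `iₖ₊₁ = r`), then the value is `κ [a i₁ * g₁, a i₂ * g₂, …, a iₖ * gₖ]`.
The factor `gₖ` is written inside the last argument; for functions that are right `B`-linear in
the last argument, as free cumulants are, this is `κ [a i₁ * g₁, …, a iₖ] * gₖ`.
The value on the empty interval is `1`. -/
def nested {B : StarSubalgebra ℂ A} (κ : List A → B) (a : ℕ → A) (blk : ℕ → Finset ℕ)
    (l r : ℕ) : B :=
  if h : l < r then
    κ (((blk l ∩ Finset.Ico l r).sort).attach.map fun i =>
      a i.1 * (nested κ a blk (i.1 + 1) (nextOr (blk l ∩ Finset.Ico l r) i.1 r) : A))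
  else 1
termination_by r - l
decreasing_by
  have h1 := nextOr_le (blk l ∩ Finset.Ico l r) i.1 r
  have h2 := (Finset.mem_sort _).1 i.2
  simp only [Finset.mem_inter, Finset.mem_Ico] at h2
  omega

/-- The bracketing `π{a₁, …, aₙ}` of a noncrossing partition `π` for the family `κ`. -/
def bracket {B : StarSubalgebra ℂ A} (κ : List A → B) (L : List A)
    (π : Finpartition (Finset.range L.length)) : B :=
  nested κ (fun i => L.getD i 0) π.part 0 L.length

open Classical in
/-- Auxiliary: the free cumulants of order at most `n` (and `0` on longer lists), obtained by
solving the moment-cumulant formula for the summand of the one-block partition. -/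
def freeCumulantUpTo {B : StarSubalgebra ℂ A} (E : A →ₗ[ℂ] B) : ℕ → List A → B
  | 0, _ => 0
  | n + 1, L =>
    if L.length ≤ n then freeCumulantUpTo E n L
    else if L.length = n + 1 then
      E L.prod - ∑ π ∈ (NC L.length).filter (fun π => π.parts ≠ {Finset.range L.length}),
        bracket (freeCumulantUpTo E n) L π
    else 0

/-- The `B`-valued free cumulant `κₙ(a₁, …, aₙ)` of `L = [a₁, …, aₙ]`, `n ≥ 1`.  These are the
unique functions with `E (a₁ ⋯ aₙ) = ∑ π ∈ NC(n), π{a₁, …, aₙ}` for all `n ≥ 1`; see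
`moment_cumulant` below. -/
def freeCumulant {B : StarSubalgebra ℂ A} (E : A →ₗ[ℂ] B) (L : List A) : B :=
  freeCumulantUpTo E L.length L

theorem freeCumulantUpTo_eq {B : StarSubalgebra ℂ A} (E : A →ₗ[ℂ] B) (n : ℕ) (L : List A)
    (h : L.length ≤ n) : freeCumulantUpTo E n L = freeCumulant E L := by
  induction n with
  | zero =>
    obtain rfl : L = [] := by simpa using h
    rfl
  | succ n ih =>
    rcases Nat.lt_or_ge n L.length with h1 | h1
    · have : L.length = n + 1 := by omega
      rw [freeCumulant, this]
    · rw [freeCumulantUpTo, if_pos h1, ih h1]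

theorem nested_congr {B : StarSubalgebra ℂ A} (κ κ' : List A → B) (a : ℕ → A)
    (blk : ℕ → Finset ℕ) (n : ℕ) (hκ : ∀ L : List A, L.length ≤ n → κ L = κ' L)
    (l r : ℕ) (hb : ∀ i, l ≤ i → i < r → (blk i).card ≤ n) :
    nested κ a blk l r = nested κ' a blk l r := by
  induction hN : r - l using Nat.strong_induction_on generalizing l r with
  | _ N ih =>
  rw [nested, nested]
  split_ifs with h
  · rw [hκ _ (by
      simpa using (Finset.card_le_card Finset.inter_subset_left).trans (hb l le_rfl h))]
    congr 1
    apply List.map_congr_left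
    intro i _
    have h1 := nextOr_le (blk l ∩ Finset.Ico l r) i.1 r
    have h2 := (Finset.mem_sort _).1 i.2
    simp only [Finset.mem_inter, Finset.mem_Ico] at h2
    rw [ih _ (by omega) _ _ (fun j hj hj' => hb j (by omega) (by omega)) rfl]
  · rfl

theorem bracket_oneBlock {B : StarSubalgebra ℂ A} (κ : List A → B) (L : List A) (hL : L ≠ [])
    (π : Finpartition (Finset.range L.length)) (hπ : π.parts = {Finset.range L.length}) :
    bracket κ L π = κ L := by
  have hpos : 0 < L.length := List.length_pos_iff.2 hL
  have hp : π.part 0 = Finset.range L.length :=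
    π.part_eq_of_mem (by simp [hπ]) (by simpa using hpos)
  have hI : π.part 0 ∩ Finset.Ico 0 L.length = Finset.range L.length := by
    rw [hp]; ext; simp
  have hnext : ∀ i, i < L.length → nextOr (Finset.range L.length) i L.length = i + 1 := by
    intro i hi
    apply le_antisymm
    · apply Finset.min'_le
      simp only [Finset.mem_insert, Finset.mem_filter, Finset.mem_range]
      omega
    · apply Finset.le_min'
      intro y hy
      simp only [Finset.mem_insert, Finset.mem_filter, Finset.mem_range] at hy
      omega
  rw [bracket, nested, dif_pos hpos]
  congr 1
  have key : ∀ i ∈ ((π.part 0 ∩ Finset.Ico 0 L.length).sort (fun a b => a ≤ b)).attach,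
      L.getD i.1 0 * (nested κ (fun i => L.getD i 0) π.part (i.1 + 1)
        (nextOr (π.part 0 ∩ Finset.Ico 0 L.length) i.1 L.length) : A) = L.getD i.1 0 := by
    intro i _
    have h2 := (Finset.mem_sort _).1 i.2
    simp only [Finset.mem_inter, Finset.mem_Ico] at h2
    have h3 : nextOr (π.part 0 ∩ Finset.Ico 0 L.length) i.1 L.length = i.1 + 1 :=
      (congrArg (fun V => nextOr V i.1 L.length) hI).trans (hnext _ h2.2.2)
    rw [h3, nested, dif_neg (lt_irrefl _)]
    simp
  rw [List.map_congr_left key, List.attach_map_val (f := fun i => L.getD i 0), hI,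
    Finset.sort_range]
  apply List.ext_getElem
  · simp
  · intro i h1 h2
    simp [h2]

/-- The moment-cumulant formula. -/
theorem moment_cumulant {B : StarSubalgebra ℂ A} (E : A →ₗ[ℂ] B) (L : List A) (hL : L ≠ []) :
    E L.prod = ∑ π ∈ NC L.length, bracket (freeCumulant E) L π := by
  classical
  have hpos : 0 < L.length := List.length_pos_iff.2 hL
  obtain ⟨n, hn⟩ : ∃ n, L.length = n + 1 := ⟨L.length - 1, by omega⟩
  have hne : (Finset.range L.length) ≠ ⊥ := by
    intro h
    have : 0 ∈ Finset.range L.length := by simpa using hpos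
    rw [h] at this
    simp at this
  have htop : ∀ π : Finpartition (Finset.range L.length),
      π.parts = {Finset.range L.length} ↔ π = Finpartition.indiscrete hne := by
    intro π
    rw [Finpartition.ext_iff]
    rfl
  rw [← Finset.sum_filter_add_sum_filter_not (NC L.length)
    (fun π => π.parts ≠ {Finset.range L.length})]
  have h1 : ∀ π ∈ (NC L.length).filter (fun π => π.parts ≠ {Finset.range L.length}),
      bracket (freeCumulantUpTo E n) L π = bracket (freeCumulant E) L π := by
    intro π hπ
    refine nested_congr _ _ _ _ n (fun M hM => freeCumulantUpTo_eq E n M hM) _ _ ?_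
    intro i _ hi
    by_contra hcard
    have hsub := π.part_subset i
    have heq : π.part i = Finset.range L.length :=
      Finset.eq_of_subset_of_card_le hsub (by simp; omega)
    have hmem : Finset.range L.length ∈ π.parts := by
      have := π.part_mem.2 (show i ∈ Finset.range L.length by simpa using hi)
      rwa [heq] at this
    refine (Finset.mem_filter.1 hπ).2 ?_
    refine Finset.eq_singleton_iff_unique_mem.2 ⟨hmem, fun P hP => ?_⟩
    obtain ⟨x, hx⟩ := π.nonempty_of_mem_parts hP
    exact (π.eq_of_mem_parts hmem hP (π.le hP hx) hx).symm
  have h2 : (NC L.length).filter (fun π => ¬ π.parts ≠ {Finset.range L.length})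
      = {Finpartition.indiscrete hne} := by
    ext π
    simp only [NC, Finset.mem_filter, Finset.mem_univ, true_and, not_not, htop,
      Finset.mem_singleton]
    constructor
    · exact fun h => h.2
    · rintro rfl
      refine ⟨?_, rfl⟩
      intro P hP Q hQ i _ k _ j _ m _ _ _ _
      simp only [Finpartition.indiscrete_parts, Finset.mem_singleton] at hP hQ
      rw [hP, hQ]
  rw [h2, Finset.sum_singleton, bracket_oneBlock _ L hL _ ((htop _).2 rfl),
    ← Finset.sum_congr rfl h1]
  have h3 : freeCumulant E L = freeCumulantUpTo E (n + 1) L := by rw [freeCumulant, hn]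
  rw [h3, freeCumulantUpTo, if_neg (by omega), if_pos hn]
  abel

/-- The letter `z` (for `true`) or `z*` (for `false`). -/
def letter (z : A) (s : Bool) : A := if s then z else star z

/-- `z` is `B`-circular with covariance `(α, β)`: the pair `(z, z*)` is `B`-Gaussian, that is,
all its `B`-valued free cumulants of order different from two vanish, and its covariance is
given by `E (z* b z) = α b`, `E (z b z*) = β b` and `E (z b z) = E (z* b z*) = 0`. -/
structure IsBCircular {B : StarSubalgebra ℂ A} (E : A →ₗ[ℂ] B) (z : A)
    (α β : B →ₗ[ℂ] B) : Prop where
  gaussian : ∀ w : List (Bool × B), w ≠ [] → w.length ≠ 2 →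
    freeCumulant E (w.map fun p => letter z p.1 * (p.2 : A)) = 0
  cov_star_self : ∀ b : B, E (star z * b * z) = α b
  cov_self_star : ∀ b : B, E (z * b * star z) = β b
  cov_self_self : ∀ b : B, E (z * b * z) = 0
  cov_star_star : ∀ b : B, E (star z * b * star z) = 0
  mean : E z = 0
  mean_star : E (star z) = 0

end Algebraic

section Banach

variable {A : Type*} [NormedRing A] [StarRing A] [NormedAlgebra ℂ A] [StarModule ℂ A]

/-- `(A, E)` is a `B`-valued Banach *-noncommutative probability space (for a Banach *-algebra
`A`): in addition `B` is closed in `A` and `E` is bounded.  (No compatibility of the norm with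
the involution is needed.) -/
structure IsBanachNCProbSpace (B : StarSubalgebra ℂ A) (E : A →ₗ[ℂ] B) : Prop
    extends IsNCProbSpace B E where
  isClosed : IsClosed (B : Set A)
  bounded : ∃ C : ℝ, ∀ a : A, ‖E a‖ ≤ C * ‖a‖

/-- The `n`-th term `E (b (x b)ⁿ)` of the series for `G̃ₓ(b)`. -/
def GtTerm {B : StarSubalgebra ℂ A} (E : A →ₗ[ℂ] B) (x : A) (b : B) (n : ℕ) : B :=
  E ((b : A) * (x * (b : A)) ^ n)

/-- `G̃ₓ(b) = ∑ₙ E (b (x b)ⁿ)`. -/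
def Gt {B : StarSubalgebra ℂ A} (E : A →ₗ[ℂ] B) (x : A) (b : B) : B :=
  ∑' n : ℕ, GtTerm E x b n

/-- The term `κₙ₊₁(x b, x b, …, x b, x)` (with `n` arguments `x b`) of the cumulant series for
the R-transform. -/
def RTerm {B : StarSubalgebra ℂ A} (E : A →ₗ[ℂ] B) (x : A) (b : B) (n : ℕ) : B :=
  freeCumulant E (List.replicate n (x * (b : A)) ++ [x])

/-- The germ at `0` of `R : B → B` is the `B`-valued R-transform of `x`, obtained by functional
inversion of `G̃ₓ`: it is analytic at `0`, and `R(b) + b⁻¹ = K(b)⁻¹` for all invertible `b` near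
`0`, where `K` is the inverse of `G̃ₓ` with respect to composition near `0`. -/
def IsRTransform {B : StarSubalgebra ℂ A} (E : A →ₗ[ℂ] B) (x : A) (R : B → B) : Prop :=
  AnalyticAt ℂ R 0 ∧
  ∃ K : B → B, AnalyticAt ℂ K 0 ∧ K 0 = 0 ∧
    (∀ᶠ b in 𝓝 (0 : B), Gt E x (K b) = b) ∧
    (∀ᶠ b in 𝓝 (0 : B), K (Gt E x b) = b) ∧
    ∀ᶠ b in 𝓝 (0 : B), IsUnit b →
      IsUnit (K b) ∧ R b + Ring.inverse b = Ring.inverse (K b)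

end Banach

end BFree

end

noncomputable section

namespace BFree

/-! Two recursions carry everything. In a Gaussian family only pair blocks survive, so the first
letter of a word is paired with some later letter, and the moment splits into the part enclosed by
the pair and the part after it (`moment_gaussian`). In the alternating word `z* c z b z* c z b ⋯`
only `z*` with `z` pair off, so the moments of `z* c z` and of `z b z*` determine each other by two
convolution recursions (`momentX_rec`, `momentY_rec`). Summed over all lengths, with geometric
bounds, they become `G = b + b α(H) G` and `H = c + c β(G) H`, where `G` and `H` are the two
transforms (`Gt_eq_add`). Solving for `G` and `H` gives part (1).

For the cumulants of `x = z* c z`, a noncrossing partition of an interval is cut at the second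
element of its first block (`sum_blockMaps_Ico`). This gives a recursion that reads the arguments of
the first block one at a time (`firstBlockSum_eq`). The moments of `x`, started with an arbitrary
middle factor `q` in `z* q z`, satisfy a recursion of the same shape, in which reading the argument
`x e` replaces `q` by `q β(e) c` (`momentStart_rec`). Comparing the two by induction on the order
yields `κₙ(x b₁, …, x bₙ) = α(c β(b₁) c ⋯ β(bₙ₋₁) c) bₙ` (`cumulantDefect_eq_zero`), and the
cumulant series of the R-transform is then a geometric series.

The functional inverse does not use these cumulants. Eliminating `H` gives `G = b + b R(G) G`, which
`K(b) = b (1 + R(b) b)⁻¹` inverts near `0` (`exists_analytic_inverse`). -/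

/-! ### Noncrossing partitions of intervals and their decomposition at the first block -/

/-- `f i` is the block of `i` in a noncrossing partition of `s` (and is empty for `i ∉ s`). -/
structure IsBlockMap (s : Finset ℕ) (f : ℕ → Finset ℕ) : Prop where
  mem : ∀ i j, j ∈ f i → i ∈ s ∧ j ∈ s
  refl : ∀ i ∈ s, i ∈ f i
  symm : ∀ i j, j ∈ f i → i ∈ f j
  trans : ∀ i j k, j ∈ f i → k ∈ f j → k ∈ f i
  nc : ∀ i j k m, i < j → j < k → k < m → k ∈ f i → m ∈ f j → j ∈ f i

open Classical in
/-- The block maps of the noncrossing partitions of `s`. -/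
def blockMaps (s : Finset ℕ) : Finset (ℕ → Finset ℕ) :=
  (Finset.univ.filter fun π : Finpartition s =>
    ∀ P ∈ π.parts, ∀ Q ∈ π.parts, ∀ i ∈ P, ∀ k ∈ P, ∀ j ∈ Q, ∀ m ∈ Q,
      i < j → j < k → k < m → P = Q).image fun π => π.part

/-- A block is recovered as the part of any of its elements. Hence sums over partitions can be taken
over functions `ℕ → Finset ℕ`, whose type does not change with the underlying set. -/
theorem part_injective (s : Finset ℕ) :
    Function.Injective fun π : Finpartition s => π.part := by
  have key : ∀ π ρ : Finpartition s, π.part = ρ.part → π.parts ⊆ ρ.parts := by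
    intro π ρ h P hP
    obtain ⟨x, hx⟩ := π.nonempty_of_mem_parts hP
    rw [← π.part_eq_of_mem hP hx, h]
    exact ρ.part_mem.2 (π.le hP hx)
  intro π ρ h
  exact Finpartition.ext (Finset.Subset.antisymm (key _ _ h) (key _ _ h.symm))

theorem sum_blockMaps_range {M : Type*} [AddCommMonoid M] (n : ℕ) (F : (ℕ → Finset ℕ) → M) :
    ∑ π ∈ NC n, F π.part = ∑ f ∈ blockMaps (Finset.range n), F f := by
  classical
  rw [blockMaps, Finset.sum_image (fun x _ y _ h => part_injective _ h)]
  refine Finset.sum_congr ?_ fun _ _ => rfl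
  ext π
  simp only [NC, Finset.mem_filter, IsNoncrossing]

theorem mem_blockMaps {s : Finset ℕ} {f : ℕ → Finset ℕ} :
    f ∈ blockMaps s ↔ IsBlockMap s f := by
  classical
  simp only [blockMaps, Finset.mem_image, Finset.mem_filter, Finset.mem_univ, true_and]
  constructor
  · rintro ⟨π, hnc, rfl⟩
    have hmem : ∀ i j, j ∈ π.part i → i ∈ s ∧ j ∈ s := fun i j h =>
      ⟨π.part_nonempty.1 ⟨j, h⟩, π.part_subset i h⟩
    have heq : ∀ i j, j ∈ π.part i → π.part j = π.part i := fun i j h =>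
      π.part_eq_of_mem (π.part_mem.2 (hmem i j h).1) h
    refine ⟨hmem, fun i hi => π.mem_part hi, fun i j h => ?_, fun i j k h h' => ?_, ?_⟩
    · rw [heq i j h]; exact π.mem_part (hmem i j h).1
    · rwa [heq i j h] at h'
    · intro i j k m hij hjk hkm hk hm
      have hi := (hmem _ _ hk).1
      have hj := (hmem _ _ hm).1
      rw [hnc _ (π.part_mem.2 hi) _ (π.part_mem.2 hj) i (π.mem_part hi) k hk j (π.mem_part hj) m hm
        hij hjk hkm]
      exact π.mem_part hj
  · intro h
    -- Off `s` the sets `f i` are empty, so equality is added to make the relation reflexive on all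
    -- of `ℕ`.
    let S : Setoid ℕ :=
      { r := fun i j => i = j ∨ j ∈ f i
        iseqv := by
          refine ⟨fun _ => Or.inl rfl, ?_, ?_⟩
          · rintro i j (rfl | hj)
            · exact Or.inl rfl
            · exact Or.inr (h.symm _ _ hj)
          · rintro i j k (rfl | hj) (rfl | hk)
            · exact Or.inl rfl
            · exact Or.inr hk
            · exact Or.inr hj
            · exact Or.inr (h.trans _ _ _ hj hk) }
    have hpart : (Finpartition.ofSetSetoid S s).part = f := by
      funext i
      ext j
      rw [Finpartition.mem_part_ofSetSetoid_iff_rel]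
      constructor
      · rintro ⟨hi, _, (rfl | hj)⟩
        · exact h.refl _ hi
        · exact hj
      · exact fun hj => ⟨(h.mem _ _ hj).1, (h.mem _ _ hj).2, Or.inr hj⟩
    refine ⟨Finpartition.ofSetSetoid S s, ?_, hpart⟩
    intro P hP Q hQ i hi k hk j hj m hm hij hjk hkm
    rw [← Finpartition.part_eq_of_mem _ hP hi, hpart] at hk ⊢
    rw [← Finpartition.part_eq_of_mem _ hQ hj, hpart] at hm ⊢
    have hji := h.nc i j k m hij hjk hkm hk hm
    ext x
    exact ⟨fun hx => h.trans _ _ _ (h.symm _ _ hji) hx, fun hx => h.trans _ _ _ hji hx⟩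

theorem blockMaps_empty : blockMaps ∅ = {fun _ => ∅} := by
  ext f
  rw [mem_blockMaps, Finset.mem_singleton]
  constructor
  · intro h
    funext i
    exact Finset.eq_empty_of_forall_notMem fun j hj => by simpa using (h.mem i j hj).1
  · rintro rfl
    constructor <;> simp

/-- Insert `l` into the block of `m` of the partition `f₂`, and add the blocks of `f₁`. -/
def glue (l r m : ℕ) (f₁ f₂ : ℕ → Finset ℕ) (i : ℕ) : Finset ℕ :=
  (Finset.Ico l r).filter fun j => (i = l ∧ j = l) ∨ j ∈ f₁ i ∨
    (if j = l then m else j) ∈ f₂ (if i = l then m else i)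

theorem mem_glue {l r m i j : ℕ} {f₁ f₂ : ℕ → Finset ℕ} :
    j ∈ glue l r m f₁ f₂ i ↔ (l ≤ j ∧ j < r) ∧ ((i = l ∧ j = l) ∨ j ∈ f₁ i ∨
      (if j = l then m else j) ∈ f₂ (if i = l then m else i)) := by
  simp [glue]

theorem isBlockMap_glue {l r m : ℕ} (hlm : l < m) (hmr : m ≤ r) {f₁ f₂ : ℕ → Finset ℕ}
    (h₁ : IsBlockMap (Finset.Ico (l + 1) m) f₁) (h₂ : IsBlockMap (Finset.Ico m r) f₂) :
    IsBlockMap (Finset.Ico l r) (glue l r m f₁ f₂) := by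
  obtain ⟨m1, r1, s1, t1, n1⟩ := h₁
  obtain ⟨m2, r2, s2, t2, n2⟩ := h₂
  simp only [Finset.mem_Ico] at *
  constructor
  · intro i j
    simp only [mem_glue, Finset.mem_Ico]
    grind
  · intro i hi
    simp only [mem_glue, Finset.mem_Ico] at *
    grind
  · intro i j
    simp only [mem_glue]
    grind
  · intro i j k
    simp only [mem_glue]
    grind
  · intro i j k n
    simp only [mem_glue]
    grind

theorem nextOr_eq_or (V : Finset ℕ) (i r : ℕ) :
    nextOr V i r = r ∨ (nextOr V i r ∈ V ∧ i < nextOr V i r) := by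
  have := Finset.min'_mem (insert r (V.filter fun j => i < j)) (Finset.insert_nonempty _ _)
  simpa [nextOr] using this

theorem nextOr_le_of_mem {V : Finset ℕ} {i r j : ℕ} (hj : j ∈ V) (hij : i < j) :
    nextOr V i r ≤ j :=
  Finset.min'_le _ _ (by simp [hj, hij])

theorem nextOr_eq {V : Finset ℕ} {i r m : ℕ} (h : m = r ∨ (m ∈ V ∧ i < m)) (hmr : m ≤ r)
    (hV : ∀ j ∈ V, i < j → m ≤ j) : nextOr V i r = m := by
  refine le_antisymm ?_ ?_
  · rcases h with rfl | h
    · exact nextOr_le _ _ _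
    · exact nextOr_le_of_mem h.1 h.2
  · rcases nextOr_eq_or V i r with h' | h'
    · omega
    · exact hV _ h'.1 h'.2

/-- The blocks of `f` in the open interval `(l, m)`. -/
def inner (l m : ℕ) (f : ℕ → Finset ℕ) (i : ℕ) : Finset ℕ :=
  if l < i ∧ i < m then f i else ∅

/-- The blocks of `f` in `[m, ∞)`, with `l` removed. -/
def outer (l m : ℕ) (f : ℕ → Finset ℕ) (i : ℕ) : Finset ℕ :=
  if m ≤ i then (f i).erase l else ∅

theorem mem_inner {l m i j : ℕ} {f : ℕ → Finset ℕ} :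
    j ∈ inner l m f i ↔ l < i ∧ i < m ∧ j ∈ f i := by
  unfold inner; split_ifs with h
  · simp [h]
  · simp only [Finset.notMem_empty, false_iff]; tauto

theorem mem_outer {l m i j : ℕ} {f : ℕ → Finset ℕ} :
    j ∈ outer l m f i ↔ m ≤ i ∧ j ≠ l ∧ j ∈ f i := by
  unfold outer; split_ifs with h <;> simp [h]

section
variable {l r m : ℕ} {f : ℕ → Finset ℕ}

/-- Here `m` is the successor of `l` in its block, or `r` if there is none. A block that meets the
gap between `l` and `m` cannot leave it: it would cross the pair `l, m` or lie in the block of `l`.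
-/
theorem isBlockMap_inner (hmr : m ≤ r)
    (hm : m = r ∨ (m ∈ f l ∧ l < m)) (hV : ∀ j ∈ f l, l < j → m ≤ j)
    (h : IsBlockMap (Finset.Ico l r) f) : IsBlockMap (Finset.Ico (l + 1) m) (inner l m f) := by
  obtain ⟨m1, r1, s1, t1, n1⟩ := h
  simp only [Finset.mem_Ico] at *
  have key : ∀ i j, l < i → i < m → j ∈ f i → l < j ∧ j < m := by
    intro i j hi him hj
    by_contra hcon
    rcases eq_or_ne j l with rfl | hjl
    · have := hV _ (s1 _ _ hj) hi; omega
    · have hj' := m1 _ _ hj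
      rcases hm with rfl | ⟨hm, _⟩
      · omega
      · rcases eq_or_ne j m with rfl | hjm
        · have := hV _ (t1 _ _ _ hm (s1 _ _ hj)) hi; omega
        · have := hV _ (n1 l i m j hi him (by omega) hm hj) hi; omega
  constructor <;> simp only [mem_inner, Finset.mem_Ico] <;> grind

theorem isBlockMap_outer (hlm : l < m) (hmr : m ≤ r)
    (hm : m = r ∨ (m ∈ f l ∧ l < m)) (hV : ∀ j ∈ f l, l < j → m ≤ j)
    (h : IsBlockMap (Finset.Ico l r) f) : IsBlockMap (Finset.Ico m r) (outer l m f) := by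
  have hin := isBlockMap_inner hmr hm hV h
  obtain ⟨m1, r1, s1, t1, n1⟩ := h
  -- A `j` strictly between `l` and `m` would by `hin` drag its whole block, and so `i`, into the
  -- gap.
  have key : ∀ i j, m ≤ i → j ≠ l → j ∈ f i → m ≤ j := by
    intro i j hi hjl hj
    by_contra hcon
    have hj' := Finset.mem_Ico.1 (m1 _ _ hj).2
    have := hin.mem j i (mem_inner.2 ⟨by omega, by omega, s1 _ _ hj⟩)
    simp only [Finset.mem_Ico] at this
    omega
  simp only [Finset.mem_Ico] at *
  constructor <;> simp only [mem_outer, Finset.mem_Ico] <;> grind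

theorem glue_inner_outer (hlm : l < m) (hmr : m ≤ r)
    (hm : m = r ∨ (m ∈ f l ∧ l < m)) (hV : ∀ j ∈ f l, l < j → m ≤ j)
    (h : IsBlockMap (Finset.Ico l r) f) : glue l r m (inner l m f) (outer l m f) = f := by
  have hin := isBlockMap_inner hmr hm hV h
  obtain ⟨m1, r1, s1, t1, n1⟩ := h
  funext i
  ext j
  simp only [mem_glue, mem_inner, mem_outer]
  have h1 := hin.mem i j
  have h2 := hin.mem j i
  simp only [mem_inner, Finset.mem_Ico] at *
  grind

end

section
variable {l r m : ℕ} {f₁ f₂ : ℕ → Finset ℕ}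

theorem nextOr_glue (hlm : l < m) (hmr : m ≤ r)
    (h₁ : IsBlockMap (Finset.Ico (l + 1) m) f₁) (h₂ : IsBlockMap (Finset.Ico m r) f₂) :
    nextOr (glue l r m f₁ f₂ l) l r = m := by
  obtain ⟨m1, r1, s1, t1, n1⟩ := h₁
  obtain ⟨m2, r2, s2, t2, n2⟩ := h₂
  simp only [Finset.mem_Ico] at *
  apply nextOr_eq _ hmr
  · simp only [mem_glue]; grind
  · simp only [mem_glue]
    rcases eq_or_lt_of_le hmr with rfl | hmr
    · grind
    · have := r2 m ⟨le_rfl, hmr⟩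
      grind

theorem inner_glue (hmr : m ≤ r)
    (h₁ : IsBlockMap (Finset.Ico (l + 1) m) f₁) (h₂ : IsBlockMap (Finset.Ico m r) f₂) :
    inner l m (glue l r m f₁ f₂) = f₁ := by
  obtain ⟨m1, r1, s1, t1, n1⟩ := h₁
  obtain ⟨m2, r2, s2, t2, n2⟩ := h₂
  funext i
  ext j
  simp only [Finset.mem_Ico, mem_glue, mem_inner] at *
  grind

theorem outer_glue (hlm : l < m)
    (h₁ : IsBlockMap (Finset.Ico (l + 1) m) f₁) (h₂ : IsBlockMap (Finset.Ico m r) f₂) :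
    outer l m (glue l r m f₁ f₂) = f₂ := by
  obtain ⟨m1, r1, s1, t1, n1⟩ := h₁
  obtain ⟨m2, r2, s2, t2, n2⟩ := h₂
  funext i
  ext j
  simp only [Finset.mem_Ico, mem_glue, mem_outer] at *
  grind

end

/-- The bijection sends `f` to the successor `m` of `l` in its block, the partition inside the gap,
and the partition of `[m, r)` left after deleting `l`. The value `m = r` means that `l` is a
singleton block. -/
theorem sum_blockMaps_Ico {M : Type*} [AddCommMonoid M] {l r : ℕ} (hlr : l < r)
    (F : (ℕ → Finset ℕ) → M) :
    ∑ f ∈ blockMaps (Finset.Ico l r), F f =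
      ∑ m ∈ Finset.Ioc l r, ∑ f₁ ∈ blockMaps (Finset.Ico (l + 1) m),
        ∑ f₂ ∈ blockMaps (Finset.Ico m r), F (glue l r m f₁ f₂) := by
  have e : ∀ m, ∑ f₁ ∈ blockMaps (Finset.Ico (l + 1) m),
      ∑ f₂ ∈ blockMaps (Finset.Ico m r), F (glue l r m f₁ f₂) =
      ∑ p ∈ blockMaps (Finset.Ico (l + 1) m) ×ˢ blockMaps (Finset.Ico m r),
        F (glue l r m p.1 p.2) := fun m => by rw [Finset.sum_product]
  simp_rw [e]
  rw [Finset.sum_sigma']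
  have hspec : ∀ f ∈ blockMaps (Finset.Ico l r), l < nextOr (f l) l r := by
    intro f _
    rcases nextOr_eq_or (f l) l r with h | h
    · omega
    · exact h.2
  refine Finset.sum_bij' (fun f _ => ⟨nextOr (f l) l r, inner l (nextOr (f l) l r) f,
      outer l (nextOr (f l) l r) f⟩) (fun x _ => glue l r x.1 x.2.1 x.2.2) ?_ ?_ ?_ ?_ ?_
  · intro f hf
    simp only [Finset.mem_sigma, Finset.mem_product, Finset.mem_Ioc, mem_blockMaps]
    exact ⟨⟨hspec f hf, nextOr_le _ _ _⟩,
      isBlockMap_inner (nextOr_le _ _ _) (nextOr_eq_or _ _ _)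
        (fun j => nextOr_le_of_mem) (mem_blockMaps.1 hf),
      isBlockMap_outer (hspec f hf) (nextOr_le _ _ _) (nextOr_eq_or _ _ _)
        (fun j => nextOr_le_of_mem) (mem_blockMaps.1 hf)⟩
  · rintro ⟨m, f₁, f₂⟩ hx
    simp only [Finset.mem_sigma, Finset.mem_product, Finset.mem_Ioc, mem_blockMaps] at hx ⊢
    exact isBlockMap_glue hx.1.1 hx.1.2 hx.2.1 hx.2.2
  · intro f hf
    exact glue_inner_outer (hspec f hf) (nextOr_le _ _ _) (nextOr_eq_or _ _ _)
        (fun j => nextOr_le_of_mem) (mem_blockMaps.1 hf)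
  · rintro ⟨m, f₁, f₂⟩ hx
    simp only [Finset.mem_sigma, Finset.mem_product, Finset.mem_Ioc, mem_blockMaps] at hx ⊢
    simp only [nextOr_glue hx.1.1 hx.1.2 hx.2.1 hx.2.2, inner_glue hx.1.2 hx.2.1 hx.2.2,
      outer_glue hx.1.1 hx.2.1 hx.2.2]
  · intro f hf
    simp only
    rw [glue_inner_outer (hspec f hf) (nextOr_le _ _ _) (nextOr_eq_or _ _ _)
        (fun j => nextOr_le_of_mem) (mem_blockMaps.1 hf)]

/-! ### Nested evaluations summed over noncrossing partitions -/

section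

variable {A : Type*} [Ring A] [StarRing A] [Algebra ℂ A] [StarModule ℂ A]
  {B : StarSubalgebra ℂ A}

/-- The arguments of `κ` for the block `V` in the nested evaluation on an interval ending
at `r`. -/
def blockArgs (κ : List A → B) (a : ℕ → A) (f : ℕ → Finset ℕ) (V : Finset ℕ) (r : ℕ) : List A :=
  V.sort.map fun i => a i * (nested κ a f (i + 1) (nextOr V i r) : A)

theorem nested_eq_blockArgs (κ : List A → B) (a : ℕ → A) (f : ℕ → Finset ℕ) {l r : ℕ}
    (h : l < r) : nested κ a f l r = κ (blockArgs κ a f (f l ∩ Finset.Ico l r) r) := by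
  rw [nested, dif_pos h, blockArgs,
    ← List.attach_map_val (f := fun i => a i * (nested κ a f (i + 1)
      (nextOr (f l ∩ Finset.Ico l r) i r) : A))]

theorem nested_self (κ : List A → B) (a : ℕ → A) (f : ℕ → Finset ℕ) (l : ℕ) :
    nested κ a f l l = 1 := by
  rw [nested, dif_neg (lt_irrefl _)]

/-- The evaluation sees blocks only through their traces on `[l, r)`. This permits replacing a glued
partition by its inner or outer piece. -/
theorem nested_congr_blocks (κ : List A → B) (a : ℕ → A) (f g : ℕ → Finset ℕ) (l r : ℕ)
    (h : ∀ i, l ≤ i → i < r → f i ∩ Finset.Ico l r = g i ∩ Finset.Ico l r) :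
    nested κ a f l r = nested κ a g l r := by
  induction hN : r - l using Nat.strong_induction_on generalizing l r with
  | _ N ih =>
  rcases lt_or_ge l r with hlr | hlr
  · rw [nested_eq_blockArgs _ _ _ hlr, nested_eq_blockArgs _ _ _ hlr, h l le_rfl hlr]
    congr 1
    apply List.map_congr_left
    intro i hi
    rw [Finset.mem_sort, Finset.mem_inter, Finset.mem_Ico] at hi
    have hn := nextOr_le (g l ∩ Finset.Ico l r) i r
    rw [ih _ (by omega) _ _ (fun j h1 h2 => ?_) rfl]
    have := h j (by omega) (by omega)
    ext x
    have hx := congrArg (x ∈ ·) this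
    simp only [Finset.mem_inter, Finset.mem_Ico, eq_iff_iff] at hx ⊢
    constructor
    · rintro ⟨h3, h4⟩; exact ⟨(hx.1 ⟨h3, by omega, by omega⟩).1, h4⟩
    · rintro ⟨h3, h4⟩; exact ⟨(hx.2 ⟨h3, by omega, by omega⟩).1, h4⟩
  · rw [nested, nested, dif_neg (by omega), dif_neg (by omega)]

/-- Gluing `l` onto the block of `m` prepends one argument, whose coefficient comes from the gap
before `m`. The later arguments are unchanged. For `m = r` the set `f₂ m` is empty and the argument
list has one entry. -/
theorem blockArgs_glue (κ : List A → B) (a : ℕ → A) {l r m : ℕ} (hlm : l < m) (hmr : m ≤ r)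
    {f₁ f₂ : ℕ → Finset ℕ}
    (h₁ : IsBlockMap (Finset.Ico (l + 1) m) f₁) (h₂ : IsBlockMap (Finset.Ico m r) f₂) :
    blockArgs κ a (glue l r m f₁ f₂) (glue l r m f₁ f₂ l) r =
      a l * (nested κ a f₁ (l + 1) m : A) :: blockArgs κ a f₂ (f₂ m) r := by
  have hsub : ∀ i j, j ∈ f₂ i → m ≤ i ∧ m ≤ j ∧ j < r := fun i j hj => by
    have := h₂.mem i j hj
    simp only [Finset.mem_Ico] at this
    omega
  have hglue : glue l r m f₁ f₂ l = insert l (f₂ m) := by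
    ext j
    have e1 := h₁.mem l j
    have e2 := hsub m j
    have e3 := h₂.refl m
    simp only [mem_glue, Finset.mem_insert, Finset.mem_Ico] at *
    grind
  have hnext := nextOr_glue hlm hmr h₁ h₂
  have hin := inner_glue hmr h₁ h₂
  have hout := outer_glue hlm h₁ h₂
  have hlt : l ∉ f₂ m := fun h => by have := hsub _ _ h; omega
  have hin' : nested κ a (glue l r m f₁ f₂) (l + 1) m = nested κ a f₁ (l + 1) m := by
    apply nested_congr_blocks
    intro i h1 h2
    have := congrFun hin i
    rw [inner, if_pos ⟨by omega, h2⟩] at this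
    rw [this]
  rw [hglue] at hnext ⊢
  rw [blockArgs, Finset.sort_insert (r := (· ≤ ·)) (fun j hj => by have := hsub _ _ hj; omega) hlt,
    List.map_cons, hnext, hin', blockArgs]
  congr 1
  apply List.map_congr_left
  intro i hi
  rw [Finset.mem_sort] at hi
  have h3 := hsub _ _ hi
  have hn : nextOr (insert l (f₂ m)) i r = nextOr (f₂ m) i r := by
    have : (insert l (f₂ m)).filter (fun j => i < j) = (f₂ m).filter (fun j => i < j) := by
      rw [Finset.filter_insert, if_neg (by omega)]
    simp only [nextOr, this]
  rw [hn]
  congr 2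
  apply nested_congr_blocks
  intro j h1 h2
  have := congrFun hout j
  rw [outer, if_pos (by omega)] at this
  rw [← this]
  ext x
  simp only [Finset.mem_inter, Finset.mem_erase, Finset.mem_Ico]
  constructor
  · rintro ⟨h4, h5⟩; exact ⟨⟨by omega, h4⟩, h5⟩
  · rintro ⟨⟨_, h4⟩, h5⟩; exact ⟨h4, h5⟩

/-- The sum over all noncrossing partitions of `[l, r)` of `G` evaluated at the arguments of `κ`
for the first block. -/
def firstBlockSum {M : Type*} [AddCommMonoid M] (κ : List A → B) (a : ℕ → A) (G : List A → M)
    (l r : ℕ) : M :=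
  ∑ f ∈ blockMaps (Finset.Ico l r), G (blockArgs κ a f (f l) r)

/-- The sum over all noncrossing partitions of `[l, r)` of `F` evaluated at the nested
evaluation. -/
def nestedSum {M : Type*} [AddCommMonoid M] (κ : List A → B) (a : ℕ → A) (F : B → M)
    (l r : ℕ) : M :=
  ∑ f ∈ blockMaps (Finset.Ico l r), F (nested κ a f l r)

section
variable {M : Type*} [AddCommMonoid M] (κ : List A → B) (a : ℕ → A)

theorem nestedSum_self (F : B → M) (l : ℕ) : nestedSum κ a F l l = F 1 := by
  simp [nestedSum, blockMaps_empty, nested_self]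

theorem firstBlockSum_self (G : List A → M) (l : ℕ) : firstBlockSum κ a G l l = G [] := by
  simp [firstBlockSum, blockMaps_empty, blockArgs]

theorem nestedSum_eq_firstBlockSum (F : B → M) {l r : ℕ} (h : l < r) :
    nestedSum κ a F l r = firstBlockSum κ a (fun L => F (κ L)) l r := by
  refine Finset.sum_congr rfl fun f hf => ?_
  rw [nested_eq_blockArgs _ _ _ h, Finset.inter_eq_left.2]
  exact fun j hj => ((mem_blockMaps.1 hf).mem _ _ hj).2

/-- The function `G` acts as a continuation: the argument just read is absorbed into it, and the
rest of the block becomes the first block of `[m, r)`. For this reason `G` is arbitrary and not only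
`freeCumulant E`. -/
theorem firstBlockSum_eq (G : List A → M) {l r : ℕ} (h : l < r) :
    firstBlockSum κ a G l r = ∑ m ∈ Finset.Ioc l r,
      nestedSum κ a (fun v => firstBlockSum κ a (fun L => G (a l * (v : A) :: L)) m r)
        (l + 1) m := by
  rw [firstBlockSum, sum_blockMaps_Ico h]
  refine Finset.sum_congr rfl fun m hm => Finset.sum_congr rfl fun f₁ h₁ =>
    Finset.sum_congr rfl fun f₂ h₂ => ?_
  rw [Finset.mem_Ioc] at hm
  rw [blockArgs_glue κ a hm.1 hm.2 (mem_blockMaps.1 h₁) (mem_blockMaps.1 h₂)]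

theorem sum_Ioc_add (F : ℕ → M) (l r s : ℕ) :
    ∑ m ∈ Finset.Ioc (l + s) (r + s), F m = ∑ m ∈ Finset.Ioc l r, F (m + s) := by
  rw [← Finset.map_add_right_Ioc, Finset.sum_map]
  rfl

/-- Translation invariance is inherited from the recursion, so no bijection between partitions of
shifted intervals is needed. -/
theorem firstBlockSum_shift (s : ℕ) (G : List A → M) (l r : ℕ) (hlr : l ≤ r) :
    firstBlockSum κ a G (l + s) (r + s) = firstBlockSum κ (fun i => a (i + s)) G l r := by
  induction hN : r - l using Nat.strong_induction_on generalizing l r G with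
  | _ N ih =>
  rcases hlr.eq_or_lt with rfl | hlr
  · rw [firstBlockSum_self, firstBlockSum_self]
  rw [firstBlockSum_eq _ _ _ (by omega), firstBlockSum_eq _ _ _ hlr, sum_Ioc_add]
  refine Finset.sum_congr rfl fun m hm => ?_
  rw [Finset.mem_Ioc] at hm
  have e : ∀ v : B, firstBlockSum κ a (fun L => G (a (l + s) * (v : A) :: L)) (m + s) (r + s) =
      firstBlockSum κ (fun i => a (i + s)) (fun L => G (a (l + s) * (v : A) :: L)) m r :=
    fun v => ih _ (by omega) _ _ _ hm.2 rfl
  simp_rw [e]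
  rw [show l + s + 1 = l + 1 + s by ring]
  rcases (show l + 1 ≤ m by omega).eq_or_lt with rfl | hlm
  · rw [nestedSum_self, nestedSum_self]
  · rw [nestedSum_eq_firstBlockSum _ _ _ (by omega), nestedSum_eq_firstBlockSum _ _ _ hlm]
    exact ih _ (by omega) _ _ _ hlm.le rfl

theorem nestedSum_shift (s : ℕ) (F : B → M) (l r : ℕ) (hlr : l ≤ r) :
    nestedSum κ a F (l + s) (r + s) = nestedSum κ (fun i => a (i + s)) F l r := by
  rcases hlr.eq_or_lt with rfl | hlr
  · rw [nestedSum_self, nestedSum_self]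
  · rw [nestedSum_eq_firstBlockSum _ _ _ (by omega), nestedSum_eq_firstBlockSum _ _ _ hlr]
    exact firstBlockSum_shift κ a s _ l r hlr.le

theorem nestedSum_congr (a' : ℕ → A) (F : B → M) (l r : ℕ) (h : ∀ i, i < r → a i = a' i) :
    nestedSum κ a F l r = nestedSum κ a' F l r := by
  have key : ∀ f l r', r' ≤ r → nested κ a f l r' = nested κ a' f l r' := by
    intro f l r' hr'
    induction hN : r' - l using Nat.strong_induction_on generalizing l r' with
    | _ N ih =>
    rcases lt_or_ge l r' with hlr | hlr
    · rw [nested_eq_blockArgs _ _ _ hlr, nested_eq_blockArgs _ _ _ hlr]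
      congr 1
      apply List.map_congr_left
      intro i hi
      rw [Finset.mem_sort, Finset.mem_inter, Finset.mem_Ico] at hi
      have hn := nextOr_le (f l ∩ Finset.Ico l r') i r'
      rw [ih _ (by omega) _ _ (by omega) rfl, h i (by omega)]
    · rw [nested, nested, dif_neg (by omega), dif_neg (by omega)]
  exact Finset.sum_congr rfl fun f _ => by rw [key f l r le_rfl]

end

/-- The moment `E (a l * a (l + 1) * ⋯ * a (r - 1))`. -/
def moment (E : A →ₗ[ℂ] B) (a : ℕ → A) (l r : ℕ) : B :=
  E (((List.range' l (r - l)).map a).prod)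

theorem moment_eq_nestedSum {E : A →ₗ[ℂ] B} (hE : IsNCProbSpace B E) (a : ℕ → A) {l r : ℕ}
    (hlr : l ≤ r) : moment E a l r = nestedSum (freeCumulant E) a id l r := by
  rcases hlr.eq_or_lt with rfl | hlr
  · have : E (1 : A) = 1 := by simpa using hE.map_coe 1
    simp [moment, nestedSum_self, this]
  set L : List A := (List.range' l (r - l)).map a with hL
  have hlen : L.length = r - l := by simp [hL]
  have hne : L ≠ [] := by
    intro h
    rw [h, List.length_nil] at hlen
    omega
  -- The moment-cumulant formula numbers its letters from `0`, so the interval is first moved there.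
  have h0 := nestedSum_shift (freeCumulant E) a l id 0 (r - l) (Nat.zero_le _)
  rw [zero_add, Nat.sub_add_cancel hlr.le] at h0
  rw [h0, moment, ← hL, moment_cumulant E L hne]
  simp only [bracket]
  rw [sum_blockMaps_range L.length fun f =>
    nested (freeCumulant E) (fun i => L.getD i 0) f 0 L.length]
  rw [Finset.range_eq_Ico]
  change nestedSum (freeCumulant E) (fun i => L.getD i 0) id 0 L.length = _
  rw [hlen]
  apply nestedSum_congr
  intro i hi
  simp [hL, List.getD_eq_getElem?_getD, hi, add_comm]

end

/-! ### Gaussian moments -/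

section

variable {A : Type*} [Ring A] [StarRing A] [Algebra ℂ A] [StarModule ℂ A]
  {B : StarSubalgebra ℂ A}

theorem moment_self {E : A →ₗ[ℂ] B} (hE : IsNCProbSpace B E) (a : ℕ → A) (l : ℕ) :
    moment E a l l = 1 := by
  simpa [moment] using hE.map_coe 1

theorem nestedSum_apply {M : Type*} [AddCommMonoid M] (κ : List A → B) (a : ℕ → A)
    (F : B →+ M) (l r : ℕ) : nestedSum κ a F l r = F (nestedSum κ a id l r) := by
  simp [nestedSum, map_sum]

theorem nestedSum_zero {M : Type*} [AddCommMonoid M] (κ : List A → B) (a : ℕ → A) (l r : ℕ) :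
    nestedSum κ a (fun _ => (0 : M)) l r = 0 := by
  simp [nestedSum]

theorem freeCumulant_eq_zero {E : A →ₗ[ℂ] B} {α β : B →ₗ[ℂ] B} {z : A}
    (hz : IsBCircular E z α β) (L : List A)
    (hL : ∀ y ∈ L, ∃ (s : Bool) (b : B), y = letter z s * (b : A)) (h0 : L ≠ [])
    (h2 : L.length ≠ 2) : freeCumulant E L = 0 := by
  have : ∃ w : List (Bool × B), L = w.map fun p => letter z p.1 * (p.2 : A) := by
    clear h0 h2
    induction L with
    | nil => exact ⟨[], rfl⟩
    | cons y L ih =>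
      obtain ⟨w, hw⟩ := ih fun y hy => hL y (List.mem_cons_of_mem _ hy)
      obtain ⟨s, b, hy⟩ := hL y List.mem_cons_self
      exact ⟨(s, b) :: w, by rw [hw, hy, List.map_cons]⟩
  obtain ⟨w, rfl⟩ := this
  exact hz.gaussian w (by simpa using h0) (by simpa using h2)

section
variable {E : A →ₗ[ℂ] B} {α β : B →ₗ[ℂ] B} {z : A} {a : ℕ → A}

/-- The block recursion is applied twice. Stopping after one argument leaves a cumulant of order
one, and continuing past two leaves order at least three. Both vanish. -/
theorem moment_eq_nestedSum_pair (hE : IsNCProbSpace B E) (hz : IsBCircular E z α β)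
    (ha : ∀ i, ∃ (s : Bool) (b : B), a i = letter z s * (b : A)) {l r : ℕ} (hlr : l < r) :
    moment E a l r = ∑ m ∈ Finset.Ioo l r, nestedSum (freeCumulant E) a
      (fun v => nestedSum (freeCumulant E) a
        (fun v' => freeCumulant E [a l * (v : A), a m * (v' : A)]) (m + 1) r) (l + 1) m := by
  have hmem : ∀ (i : ℕ) (v : B), ∃ (s : Bool) (b : B), a i * (v : A) = letter z s * (b : A) := by
    intro i v
    obtain ⟨s, b, h⟩ := ha i
    exact ⟨s, b * v, by rw [h, mul_assoc]; rfl⟩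
  rw [moment_eq_nestedSum hE a hlr.le, nestedSum_eq_firstBlockSum _ _ _ hlr,
    firstBlockSum_eq _ _ _ hlr, ← Finset.Ioo_insert_right hlr,
    Finset.sum_insert (by simp)]
  have h1 : ∀ v : B, firstBlockSum (freeCumulant E) a
      (fun L => id (freeCumulant E (a l * (v : A) :: L))) r r = 0 := by
    intro v
    rw [firstBlockSum_self]
    refine freeCumulant_eq_zero hz _ ?_ (by simp) (by simp)
    intro y hy
    rw [List.mem_singleton.1 hy]
    exact hmem _ _
  simp_rw [h1]
  rw [nestedSum_zero, zero_add]
  refine Finset.sum_congr rfl fun m hm => ?_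
  rw [Finset.mem_Ioo] at hm
  congr 1
  funext v
  -- Only the index `r` ends the block at its second element `m`.
  rw [firstBlockSum_eq _ _ _ hm.2, Finset.sum_eq_single_of_mem r (by simp [hm.2])]
  · simp_rw [firstBlockSum_self]
    rfl
  · intro m' hm' hne
    rw [Finset.mem_Ioc] at hm'
    rw [← nestedSum_zero (freeCumulant E) a (m + 1) m']
    congr 1
    funext v'
    refine Finset.sum_eq_zero fun f hf => ?_
    have hm'f : m' ∈ f m' := (mem_blockMaps.1 hf).refl m' (by simp; omega)
    refine freeCumulant_eq_zero hz _ ?_ (by simp) ?_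
    · intro y hy
      rw [List.mem_cons, List.mem_cons] at hy
      rcases hy with rfl | rfl | hy
      · exact hmem _ _
      · exact hmem _ _
      · obtain ⟨i, _, rfl⟩ := List.mem_map.1 hy
        exact hmem _ _
    · have : (f m').card ≠ 0 := Finset.card_ne_zero_of_mem hm'f
      simp [blockArgs]
      exact Finset.ne_empty_of_mem hm'f

/-- This is the previous formula for a word of two letters, where a single pairing is available. -/
theorem freeCumulant_pair (hE : IsNCProbSpace B E) (hz : IsBCircular E z α β) {y y' : A}
    (hy : ∃ (s : Bool) (b : B), y = letter z s * (b : A))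
    (hy' : ∃ (s : Bool) (b : B), y' = letter z s * (b : A)) :
    freeCumulant E [y, y'] = E (y * y') := by
  have h := moment_eq_nestedSum_pair (a := fun i => if i = 0 then y else y') hE hz
    (by intro i; split_ifs <;> assumption) (l := 0) (r := 2) (by norm_num)
  rw [show Finset.Ioo 0 2 = {1} from rfl, Finset.sum_singleton, nestedSum_self,
    nestedSum_self] at h
  simpa [moment, List.range'] using h.symm

/-- The first letter of a Gaussian moment is paired with one of the later letters. -/
theorem moment_gaussian (hE : IsNCProbSpace B E) (hz : IsBCircular E z α β)
    (ha : ∀ i, ∃ (s : Bool) (b : B), a i = letter z s * (b : A)) {l r : ℕ} (hlr : l < r) :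
    moment E a l r = ∑ m ∈ Finset.Ioo l r,
      E (a l * (moment E a (l + 1) m : A) * a m) * moment E a (m + 1) r := by
  have hmem : ∀ (i : ℕ) (v : B), ∃ (s : Bool) (b : B), a i * (v : A) = letter z s * (b : A) := by
    intro i v
    obtain ⟨s, b, h⟩ := ha i
    exact ⟨s, b * v, by rw [h, mul_assoc]; rfl⟩
  rw [moment_eq_nestedSum_pair hE hz ha hlr]
  refine Finset.sum_congr rfl fun m hm => ?_
  rw [Finset.mem_Ioo] at hm
  have e1 : ∀ v v' : B, freeCumulant E [a l * (v : A), a m * (v' : A)] =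
      AddMonoidHom.mulLeft (E (a l * (v : A) * a m)) v' := by
    intro v v'
    rw [freeCumulant_pair hE hz (hmem _ _) (hmem _ _), ← mul_assoc, hE.map_mul_right]
    rfl
  simp_rw [e1]
  simp_rw [nestedSum_apply, ← moment_eq_nestedSum hE a (show m + 1 ≤ r by omega)]
  -- By additivity, the sum over partitions of the gap passes inside `E` and becomes a moment.
  let F : B →+ B := AddMonoidHom.mk' (fun v => E (a l * (v : A) * a m) * moment E a (m + 1) r)
    (fun v v' => by simp [mul_add, add_mul])
  exact (nestedSum_apply _ _ F _ _).trans
    (congrArg F (moment_eq_nestedSum hE a (show l + 1 ≤ m by omega)).symm)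

end

end

/-! ### Alternating words in `z*` and `z` -/

theorem prod_map_range'_two_mul {R : Type*} [Monoid R] (a : ℕ → R) (s n l : ℕ) :
    ((List.range' (2 * l + s) (2 * n)).map a).prod =
      ((List.range' l n).map fun i => a (2 * i + s) * a (2 * i + s + 1)).prod := by
  induction n generalizing l with
  | zero => simp
  | succ n ih =>
    have := ih (l + 1)
    rw [show 2 * (l + 1) + s = 2 * l + s + 1 + 1 by ring] at this
    rw [show 2 * (n + 1) = 2 * n + 1 + 1 by ring, List.range'_succ, List.range'_succ,
      List.range'_succ]
    simp only [List.map_cons, List.prod_cons, this, mul_assoc]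

theorem sum_Ioo_two_mul {M : Type*} [AddCommMonoid M] (F : ℕ → M) (l r : ℕ)
    (hF : ∀ k, F (2 * k) = 0) :
    ∑ m ∈ Finset.Ioo (2 * l) (2 * r), F m = ∑ k ∈ Finset.Ico l r, F (2 * k + 1) := by
  symm
  rw [← Finset.sum_image (f := F) (g := fun k => 2 * k + 1)
    (fun x _ y _ h => by simpa using h)]
  refine Finset.sum_subset ?_ ?_
  · intro m hm
    simp only [Finset.mem_image, Finset.mem_Ico, Finset.mem_Ioo] at *
    omega
  · intro m hm hm'
    rcases Nat.even_or_odd' m with ⟨k, rfl | rfl⟩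
    · exact hF k
    · refine absurd (Finset.mem_image.2 ⟨k, ?_, rfl⟩) hm'
      simp only [Finset.mem_Ico, Finset.mem_Ioo] at *
      omega

theorem sum_Ioo_two_mul_add_one {M : Type*} [AddCommMonoid M] (F : ℕ → M) (l r : ℕ)
    (hF : ∀ k, F (2 * k + 1) = 0) :
    ∑ m ∈ Finset.Ioo (2 * l + 1) (2 * r + 1), F m =
      ∑ k ∈ Finset.Ioc l r, F (2 * k) := by
  symm
  rw [← Finset.sum_image (f := F) (g := fun k => 2 * k)
    (fun x _ y _ h => by simpa using h)]
  refine Finset.sum_subset ?_ ?_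
  · intro m hm
    simp only [Finset.mem_image, Finset.mem_Ioc, Finset.mem_Ioo] at *
    omega
  · intro m hm hm'
    rcases Nat.even_or_odd' m with ⟨k, rfl | rfl⟩
    · refine absurd (Finset.mem_image.2 ⟨k, ?_, rfl⟩) hm'
      simp only [Finset.mem_Ioc, Finset.mem_Ioo] at *
      omega
    · exact hF k

section

variable {A : Type*} [Ring A] [StarRing A] [Algebra ℂ A] [StarModule ℂ A]
  {B : StarSubalgebra ℂ A}

/-- The alternating word `z* c, z (b 0), z* c, z (b 1), …`. -/
def altWord (z : A) (b : ℕ → B) (c : B) (n : ℕ) : A :=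
  if n % 2 = 0 then star z * (c : A) else z * (b (n / 2) : A)

theorem altWord_even (z : A) (b : ℕ → B) (c : B) (n : ℕ) :
    altWord z b c (2 * n) = star z * (c : A) := by
  simp [altWord]

theorem altWord_odd (z : A) (b : ℕ → B) (c : B) (n : ℕ) :
    altWord z b c (2 * n + 1) = z * (b n : A) := by
  have : (2 * n + 1) / 2 = n := by omega
  simp [altWord, this]

/-- The moment `E (x b_l x b_{l+1} ⋯ x b_{r-1})` for `x = z* c z`. -/
def momentX (E : A →ₗ[ℂ] B) (z : A) (b : ℕ → B) (c : B) (l r : ℕ) : B :=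
  moment E (altWord z b c) (2 * l) (2 * r)

/-- The moment `E (z b_l z* c z b_{l+1} z* c ⋯ z b_{r-1} z* c)`. -/
def momentY (E : A →ₗ[ℂ] B) (z : A) (b : ℕ → B) (c : B) (l r : ℕ) : B :=
  moment E (altWord z b c) (2 * l + 1) (2 * r + 1)

theorem momentX_eq (E : A →ₗ[ℂ] B) (z : A) (b : ℕ → B) (c : B) (l r : ℕ) :
    momentX E z b c l r = moment E (fun i => star z * c * z * b i) l r := by
  have := prod_map_range'_two_mul (altWord z b c) 0 (r - l) l
  simp only [add_zero] at this
  rw [momentX, moment, moment, show 2 * r - 2 * l = 2 * (r - l) by omega, this]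
  simp only [altWord_even, altWord_odd, mul_assoc]

theorem momentY_eq (E : A →ₗ[ℂ] B) (z : A) (b : ℕ → B) (c : B) (l r : ℕ) :
    momentY E z b c l r = moment E (fun i => z * b i * star z * c) l r := by
  have := prod_map_range'_two_mul (altWord z b c) 1 (r - l) l
  rw [momentY, moment, moment, show 2 * r + 1 - (2 * l + 1) = 2 * (r - l) by omega, this]
  have e : ∀ i, altWord z b c (2 * i + 1 + 1) = star z * c := fun i =>
    altWord_even z b c (i + 1)
  simp only [e, altWord_odd, mul_assoc]

section
variable {E : A →ₗ[ℂ] B} {α β : B →ₗ[ℂ] B} {z : A}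

theorem altWord_eq_letter (z : A) (b : ℕ → B) (c : B) (i : ℕ) :
    ∃ (s : Bool) (d : B), altWord z b c i = letter z s * (d : A) := by
  unfold altWord
  split_ifs
  · exact ⟨false, c, rfl⟩
  · exact ⟨true, b (i / 2), rfl⟩

theorem momentY_self (hE : IsNCProbSpace B E) (b : ℕ → B) (c : B) (l : ℕ) :
    momentY E z b c l l = 1 := moment_self hE _ _

/-- The initial `z*` can only pair with a `z`, that is, with an odd position `2k + 1`. The enclosed
word then starts with `z` and ends with `z* c`, which is a `momentY`. -/
theorem momentX_rec (hE : IsNCProbSpace B E) (hz : IsBCircular E z α β) (b : ℕ → B) (c : B)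
    {l r : ℕ} (hlr : l < r) :
    momentX E z b c l r =
      ∑ k ∈ Finset.Ico l r, α (c * momentY E z b c l k) * b k * momentX E z b c (k + 1) r := by
  rw [momentX, moment_gaussian hE hz (altWord_eq_letter z b c) (by omega), sum_Ioo_two_mul]
  · refine Finset.sum_congr rfl fun k _ => ?_
    rw [altWord_even, altWord_odd, ← mul_assoc, hE.map_mul_right, mul_assoc (star z),
      ← hz.cov_star_self]
    rfl
  · intro k
    have := hz.cov_star_star (c * moment E (altWord z b c) (2 * l + 1) (2 * k))
    rw [altWord_even, altWord_even, ← mul_assoc, hE.map_mul_right, mul_assoc (star z)]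
    simp only [MulMemClass.coe_mul] at this
    rw [this, zero_mul, zero_mul]

/-- Dually, the initial `z` at position `2l + 1` pairs with a `z*` at an even position `2k`. The
enclosed word is again of the `momentX` kind. -/
theorem momentY_rec (hE : IsNCProbSpace B E) (hz : IsBCircular E z α β) (b : ℕ → B) (c : B)
    {l r : ℕ} (hlr : l < r) :
    momentY E z b c l r = ∑ k ∈ Finset.Ioc l r,
      β (b l * momentX E z b c (l + 1) k) * c * momentY E z b c k r := by
  rw [momentY, moment_gaussian hE hz (altWord_eq_letter z b c) (by omega),
    sum_Ioo_two_mul_add_one]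
  · refine Finset.sum_congr rfl fun k _ => ?_
    rw [altWord_even, altWord_odd, ← mul_assoc, hE.map_mul_right, mul_assoc z,
      ← hz.cov_self_star]
    rfl
  · intro k
    have := hz.cov_self_self (b l * moment E (altWord z b c) (2 * l + 1 + 1) (2 * k + 1))
    rw [altWord_odd, altWord_odd, ← mul_assoc, hE.map_mul_right, mul_assoc z]
    simp only [MulMemClass.coe_mul] at this
    rw [this, zero_mul, zero_mul]

end

end

/-! ### The free cumulants of `z* c z` -/

section

variable {A : Type*} [Ring A] [StarRing A] [Algebra ℂ A] [StarModule ℂ A]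
  {B : StarSubalgebra ℂ A}

/-- `c * β b₁ * c * β b₂ * ⋯ * β bₖ * c` for the list `[b₁, …, bₖ]`. -/
def betaChain (β : B →ₗ[ℂ] B) (c : B) (p : List B) : B :=
  p.foldl (fun q e => q * β e * c) c

theorem betaChain_concat (β : B →ₗ[ℂ] B) (c : B) (p : List B) (e : B) :
    betaChain β c (p ++ [e]) = betaChain β c p * β e * c := by
  simp [betaChain]

theorem betaChain_replicate (β : B →ₗ[ℂ] B) (c e : B) (n : ℕ) :
    betaChain β c (List.replicate n e) = (c * β e) ^ n * c := by
  induction n with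
  | zero => simp [betaChain]
  | succ n ih => rw [List.replicate_succ', betaChain_concat, ih, pow_succ]; simp only [mul_assoc]

/-- The difference of `κₙ(x b₁, …, x bₙ)`, where `x = z* c z`, and
`α (c * β b₁ * c * ⋯ * β bₙ₋₁ * c) * bₙ`. -/
def cumulantDefect (E : A →ₗ[ℂ] B) (α β : B →ₗ[ℂ] B) (z : A) (c : B) (w : List B) : B :=
  freeCumulant E (w.map fun b : B => star z * c * z * (b : A)) -
    α (betaChain β c w.dropLast) * w.getLastD 0

/-- The moment `E (z* q z b_l x b_{l+1} x ⋯ x b_{r-1})`, for `x = z* c z`. -/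
def momentStart (E : A →ₗ[ℂ] B) (α : B →ₗ[ℂ] B) (z : A) (b : ℕ → B) (c q : B) (l r : ℕ) : B :=
  ∑ k ∈ Finset.Ico l r, α (q * momentY E z b c l k) * b k * momentX E z b c (k + 1) r

section
variable {E : A →ₗ[ℂ] B} {α β : B →ₗ[ℂ] B} {z : A}

theorem momentStart_add (b : ℕ → B) (c q q' : B) (l r : ℕ) :
    momentStart E α z b c (q + q') l r =
      momentStart E α z b c q l r + momentStart E α z b c q' l r := by
  simp [momentStart, add_mul, Finset.sum_add_distrib]

/-- The first term is the case where the initial `z*` pairs with the nearest `z`. In all others the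
enclosed word is nonempty; expanding it by `momentY_rec` and exchanging the sums leaves a word of
the same kind with a longer middle factor. -/
theorem momentStart_rec (hE : IsNCProbSpace B E) (hz : IsBCircular E z α β) (b : ℕ → B)
    (c q : B) {l r : ℕ} (hlr : l < r) :
    momentStart E α z b c q l r = α q * b l * momentX E z b c (l + 1) r +
      ∑ m ∈ Finset.Ioo l r,
        momentStart E α z b c (q * β (b l * momentX E z b c (l + 1) m) * c) m r := by
  rw [momentStart, ← Finset.Ioo_insert_left hlr, Finset.sum_insert (by simp),
    momentY_self hE, mul_one]
  congr 1
  simp only [momentStart]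
  rw [← Finset.sum_comm' (s := Finset.Ioo l r) (t := fun k => Finset.Ioc l k)
    (by intro x y; simp only [Finset.mem_Ioo, Finset.mem_Ioc, Finset.mem_Ico]; omega)]
  refine Finset.sum_congr rfl fun k hk => ?_
  rw [momentY_rec hE hz b c (Finset.mem_Ioo.1 hk).1, Finset.mul_sum, map_sum, Finset.sum_mul,
    Finset.sum_mul]
  simp only [mul_assoc]

/-- The list `p` holds the arguments of the first block read so far. Both sides obey the same
recursion as long as the cumulant formula holds for the full argument list. That list has at most
`N` entries, where the formula is assumed, unless all remaining letters lie in the first block; this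
one case contributes the defect. -/
theorem firstBlockSum_freeCumulant (hE : IsNCProbSpace B E) (hz : IsBCircular E z α β)
    (b : ℕ → B) (c : B) (N : ℕ)
    (hN : ∀ w : List B, w ≠ [] → w.length ≤ N → cumulantDefect E α β z c w = 0)
    (l r : ℕ) (hlr : l < r) (p : List B) (hp : p.length + (r - l) ≤ N + 1) :
    firstBlockSum (freeCumulant E) (fun i => star z * c * z * (b i : A))
        (fun L => freeCumulant E ((p.map fun e : B => star z * c * z * (e : A)) ++ L)) l r =
      momentStart E α z b c (betaChain β c p) l r +
        cumulantDefect E α β z c (p ++ (List.range' l (r - l)).map b) := by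
  set y : ℕ → A := fun i => star z * c * z * (b i : A) with hy
  induction hn : r - l using Nat.strong_induction_on generalizing l p with
  | _ n ih =>
  have hnested : ∀ m, l + 1 ≤ m →
      nestedSum (freeCumulant E) y id (l + 1) m = momentX E z b c (l + 1) m := fun m hm => by
    rw [momentX_eq, moment_eq_nestedSum hE _ hm]
  have hlist : ∀ (v : B) (L : List A), (p.map fun e : B => star z * c * z * (e : A)) ++
      (y l * (v : A) :: L) = ((p ++ [b l * v]).map fun e : B => star z * c * z * (e : A)) ++ L := by
    intro v L
    simp [hy, mul_assoc]
  have hlast : ∀ v : B,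
      firstBlockSum (freeCumulant E) y (fun L => freeCumulant E
        ((p.map fun e : B => star z * c * z * (e : A)) ++ (y l * (v : A) :: L))) r r =
      AddMonoidHom.mulLeft (α (betaChain β c p) * b l) v +
        cumulantDefect E α β z c (p ++ b l * v :: (List.range' r (r - r)).map b) := by
    intro v
    rw [firstBlockSum_self, hlist]
    simp [cumulantDefect, mul_assoc]
  have hmid : ∀ m ∈ Finset.Ioo l r, ∀ v : B,
      firstBlockSum (freeCumulant E) y (fun L => freeCumulant E
        ((p.map fun e : B => star z * c * z * (e : A)) ++ (y l * (v : A) :: L))) m r =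
      AddMonoidHom.mk' (fun v => momentStart E α z b c (betaChain β c p * β (b l * v) * c) m r)
        (fun v v' => by simp only [mul_add, add_mul, map_add, momentStart_add]) v +
        cumulantDefect E α β z c (p ++ b l * v :: (List.range' m (r - m)).map b) := by
    intro m hm v
    rw [Finset.mem_Ioo] at hm
    simp_rw [hlist]
    rw [ih (r - m) (by omega) m hm.2 _ (by simp; omega) rfl, betaChain_concat]
    simp
  have hdefect : ∑ m ∈ Finset.Ioc l r, nestedSum (freeCumulant E) y (fun v =>
      cumulantDefect E α β z c (p ++ b l * v :: (List.range' m (r - m)).map b)) (l + 1) m =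
      cumulantDefect E α β z c (p ++ (List.range' l (r - l)).map b) := by
    -- For `m > l + 1` at least one letter falls into the gap, so the list has length at most `N`
    -- and its defect is zero by `hN`.
    rw [Finset.sum_eq_single_of_mem (l + 1) (by simp; omega)]
    · rw [nestedSum_self, mul_one, show r - l = (r - (l + 1)) + 1 by omega, List.range'_succ,
        List.map_cons]
    · intro m hm hne
      rw [Finset.mem_Ioc] at hm
      rw [← nestedSum_zero (freeCumulant E) y (l + 1) m]
      congr 1
      funext v
      exact hN _ (by simp) (by simp; omega)
  have hadd : ∀ (F G : B → B) (l m : ℕ), nestedSum (freeCumulant E) y (fun v => F v + G v) l m =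
      nestedSum (freeCumulant E) y F l m + nestedSum (freeCumulant E) y G l m := fun F G l m =>
    Finset.sum_add_distrib
  rw [firstBlockSum_eq _ _ _ hlr, ← hn, ← hdefect, ← Finset.Ioo_insert_right hlr,
    Finset.sum_insert (by simp), Finset.sum_insert (by simp), momentStart_rec hE hz b c _ hlr]
  simp_rw [hlast]
  rw [hadd, nestedSum_apply, hnested r (by omega), add_add_add_comm]
  refine congrArg₂ (· + ·) rfl ?_
  rw [← Finset.sum_add_distrib]
  refine Finset.sum_congr rfl fun m hm => ?_
  simp_rw [hmid m hm]
  rw [hadd, nestedSum_apply, hnested m (by simp at hm; omega)]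
  rfl

/-- The free cumulants of `x = z* c z`:
`κₙ(x b₁, …, x bₙ) = α (c * β b₁ * c * ⋯ * β bₙ₋₁ * c) * bₙ`. -/
theorem cumulantDefect_eq_zero (hE : IsNCProbSpace B E) (hz : IsBCircular E z α β) (c : B)
    (w : List B) (hw : w ≠ []) : cumulantDefect E α β z c w = 0 := by
  induction hn : w.length using Nat.strong_induction_on generalizing w with
  | _ n ih =>
  have hpos : 0 < w.length := List.length_pos_iff.2 hw
  set b : ℕ → B := fun i => w.getD i 0 with hb
  have h := firstBlockSum_freeCumulant hE hz b c (n - 1)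
    (fun w' h0 h1 => ih _ (by omega) w' h0 rfl) 0 n (by omega) [] (by simp; omega)
  have h1 : firstBlockSum (freeCumulant E) (fun i => star z * c * z * (b i : A))
      (fun L => freeCumulant E L) 0 n = momentX E z b c 0 n := by
    rw [momentX_eq, moment_eq_nestedSum hE _ (Nat.zero_le _),
      nestedSum_eq_firstBlockSum _ _ _ (by omega)]
    rfl
  have h2 : (List.range' 0 n).map b = w := by
    apply List.ext_getElem
    · simp [hn]
    · intro i h1 h2
      simp [hb, h2]
  simp only [List.map_nil, List.nil_append, Nat.sub_zero, h2] at h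
  -- With empty `p` the chain is `c`, so `momentStart` is exactly the right side of `momentX_rec`.
  -- Both sides contain the same moment, and what remains is the defect.
  rw [h1, momentX_rec hE hz b c (by omega)] at h
  exact (add_eq_left.1 h.symm)

theorem freeCumulant_star_mul_mul (hE : IsNCProbSpace B E) (hz : IsBCircular E z α β)
    (b c : B) (n : ℕ) :
    freeCumulant E (List.replicate n (star z * c * z * (b : A)) ++ [star z * c * z]) =
      α ((c * β b) ^ n * c) := by
  -- The last coefficient is `1` because the last argument of the series is `x` and not `x b`.
  have h := cumulantDefect_eq_zero hE hz c (List.replicate n b ++ [1]) (by simp)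
  rw [cumulantDefect, sub_eq_zero] at h
  simpa [betaChain_replicate] using h

end

end

/-! ### Functional inversion in a Banach algebra -/

theorem ringInverse_eq_of_mul_eq_one {R : Type*} [MonoidWithZero R] {k y : R} (hk : IsUnit k)
    (h : k * y = 1) : y = Ring.inverse k := by
  rw [← Ring.inverse_mul_cancel_left k y hk, h, mul_one]

/-- If `G b = b + b * R (G b) * G b` near `0`, then `G` is inverted near `0` by
`K b = b * (1 + R b * b)⁻¹`. -/
theorem exists_analytic_inverse {R : Type*} [NormedRing R] [NormedAlgebra ℂ R] [CompleteSpace R]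
    (φ G : R → R) (hφ : AnalyticAt ℂ φ 0) (hG : Tendsto G (𝓝 0) (𝓝 0))
    (h : ∀ᶠ b in 𝓝 (0 : R), G b = b + b * φ (G b) * G b) :
    ∃ K : R → R, AnalyticAt ℂ K 0 ∧ K 0 = 0 ∧
      (∀ᶠ b in 𝓝 (0 : R), G (K b) = b) ∧ (∀ᶠ b in 𝓝 (0 : R), K (G b) = b) ∧
      ∀ᶠ b in 𝓝 (0 : R), IsUnit b →
        IsUnit (K b) ∧ φ b + Ring.inverse b = Ring.inverse (K b) := by
  set F : R → R := fun b => φ b * b with hF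
  set u : R → R := fun b => 1 + F b with hu
  have hFan : AnalyticAt ℂ F 0 := hφ.mul analyticAt_id
  have huan : AnalyticAt ℂ u 0 := analyticAt_const.add hFan
  have hu0 : u 0 = 1 := by simp [hu, hF]
  have hinv : AnalyticAt ℂ (fun b => Ring.inverse (u b)) 0 := by
    refine AnalyticAt.comp (g := Ring.inverse) ?_ huan
    rw [hu0]
    exact analyticAt_inverse (1 : Rˣ)
  have hunit : ∀ᶠ b in 𝓝 (0 : R), IsUnit (u b) :=
    huan.continuousAt.eventually (by rw [hu0]; exact Units.nhds (1 : Rˣ))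
  set K : R → R := fun b => b * Ring.inverse (u b) with hK
  have hKan : AnalyticAt ℂ K 0 := analyticAt_id.mul hinv
  have hK0 : K 0 = 0 := by simp [hK]
  have hKt : Tendsto K (𝓝 0) (𝓝 0) := by
    have := hKan.continuousAt.tendsto
    rwa [hK0] at this
  refine ⟨K, hKan, hK0, ?_, ?_, ?_⟩
  -- Both `b` and `G (K b)` solve `g = K b + K b * F g`. Since `F` is Lipschitz near `0` and `K b`
  -- is small, the right side is a contraction there, so the two solutions agree.
  · obtain ⟨L, s, hs, hL⟩ := hFan.hasStrictFDerivAt.exists_lipschitzOnWith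
    have hsmall : ∀ᶠ b in 𝓝 (0 : R), ‖K b‖ * L < 1 := by
      have : Tendsto (fun b => ‖K b‖ * L) (𝓝 0) (𝓝 0) := by
        simpa using hKt.norm.mul_const (L : ℝ)
      exact this.eventually (gt_mem_nhds one_pos)
    filter_upwards [hunit, hs, (hG.comp hKt).eventually hs, hsmall, hKt.eventually h]
      with b hub hbs hgs hlt hg
    have hb : b = K b + K b * F b := by
      have : K b * u b = b := by rw [hK, mul_assoc, Ring.inverse_mul_cancel _ hub, mul_one]
      rw [hu, mul_add, mul_one] at this
      exact this.symm
    have hdiff : G (K b) - b = K b * (F (G (K b)) - F b) := by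
      have hg' : G (K b) = K b + K b * F (G (K b)) := by
        rw [hF, ← mul_assoc]
        exact hg
      refine (congrArg₂ (· - ·) hg' hb).trans ?_
      simp only [mul_sub, add_sub_add_left_eq_sub]
    have hle : ‖G (K b) - b‖ ≤ ‖K b‖ * L * ‖G (K b) - b‖ := by
      calc ‖G (K b) - b‖ = ‖K b * (F (G (K b)) - F b)‖ := by rw [← hdiff]
        _ ≤ ‖K b‖ * ‖F (G (K b)) - F b‖ := norm_mul_le _ _
        _ ≤ ‖K b‖ * (L * ‖G (K b) - b‖) := by
          gcongr
          exact hL.norm_sub_le hgs hbs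
        _ = _ := by ring
    have h0 : ‖G (K b) - b‖ = 0 := by
      by_contra hne
      have hpos := lt_of_le_of_ne (norm_nonneg _) (Ne.symm hne)
      nlinarith
    exact sub_eq_zero.1 (norm_eq_zero.1 h0)
  · filter_upwards [h, hG.eventually hunit] with b hb hub
    have : G b = b * u (G b) := by
      rw [hu, hF, mul_add, mul_one, ← mul_assoc]
      exact hb
    have h2 : b * u (G b) * Ring.inverse (u (G b)) = b :=
      Ring.mul_inverse_cancel_right _ _ hub
    rwa [← this] at h2
  · filter_upwards [hunit] with b hub hb
    have hKu : IsUnit (K b) := hb.mul hub.ringInverse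
    refine ⟨hKu, ringInverse_eq_of_mul_eq_one hKu ?_⟩
    have : φ b + Ring.inverse b = u b * Ring.inverse b := by
      rw [hu, hF, add_mul, one_mul, Ring.mul_inverse_cancel_right _ _ hb, add_comm]
    rw [this, hK, mul_assoc, Ring.inverse_mul_cancel_left _ _ hub, Ring.mul_inverse_cancel _ hb]

/-! ### Convergence and the equations for the two transforms -/

/-- Summation of the convolution recursion `u (n + 1) = ∑ₖ v k * u (n - k)`. -/
theorem tsum_eq_add_mul_tsum {R : Type*} [NormedRing R] [CompleteSpace R] {u v : ℕ → R}
    (hu : Summable fun n => ‖u n‖) (hv : Summable fun n => ‖v n‖)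
    (h : ∀ n, u (n + 1) = ∑ k ∈ Finset.range (n + 1), v k * u (n - k)) :
    ∑' n, u n = u 0 + (∑' n, v n) * ∑' n, u n := by
  rw [tsum_mul_tsum_eq_tsum_sum_range_of_summable_norm hv hu, hu.of_norm.tsum_eq_zero_add]
  simp_rw [h]

section

variable {A : Type*} [Ring A] [StarRing A] [Algebra ℂ A] [StarModule ℂ A]
  {B : StarSubalgebra ℂ A} {E : A →ₗ[ℂ] B} {α β : B →ₗ[ℂ] B} {z : A}

theorem momentX_const (E : A →ₗ[ℂ] B) (z : A) (b c : B) (l r : ℕ) :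
    momentX E z (fun _ => b) c l r = E ((star z * c * z * b) ^ (r - l)) := by
  rw [momentX_eq, moment]
  simp

theorem momentY_const (E : A →ₗ[ℂ] B) (z : A) (b c : B) (l r : ℕ) :
    momentY E z (fun _ => b) c l r = E ((z * b * star z * c) ^ (r - l)) := by
  rw [momentY_eq, moment]
  simp

end

section

variable {A : Type*} [NormedRing A] [StarRing A] [NormedAlgebra ℂ A] [StarModule ℂ A]
  {B : StarSubalgebra ℂ A} {E : A →ₗ[ℂ] B} {α β : B →ₗ[ℂ] B} {z : A}

theorem GtTerm_eq (hE : IsNCProbSpace B E) (x : A) (b : B) (n : ℕ) :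
    GtTerm E x b n = b * E ((x * b) ^ n) := hE.map_mul_left _ _

theorem GtTerm_zero (hE : IsNCProbSpace B E) (x : A) (b : B) : GtTerm E x b 0 = b := by
  simp [GtTerm, hE.map_coe]

/-- This is `momentX_rec` with constant coefficients, multiplied by `b` on the left. The factors `c`
and `b` in front of the moments turn them into terms of the two series. -/
theorem GtTerm_star_mul_mul_succ (hE : IsNCProbSpace B E) (hz : IsBCircular E z α β) (b c : B)
    (n : ℕ) :
    GtTerm E (star z * c * z) b (n + 1) = ∑ k ∈ Finset.range (n + 1),
      b * α (GtTerm E (z * b * star z) c k) * GtTerm E (star z * c * z) b (n - k) := by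
  have h := momentX_rec hE hz (fun _ => b) c (Nat.succ_pos n)
  simp only [momentX_const, momentY_const, Nat.sub_zero] at h
  rw [GtTerm_eq hE, h, Finset.mul_sum, Finset.range_eq_Ico]
  refine Finset.sum_congr rfl fun k _ => ?_
  rw [GtTerm_eq hE, GtTerm_eq hE, Nat.succ_sub_succ]
  simp only [mul_assoc]

theorem GtTerm_mul_mul_star_succ (hE : IsNCProbSpace B E) (hz : IsBCircular E z α β) (b c : B)
    (n : ℕ) :
    GtTerm E (z * b * star z) c (n + 1) = ∑ k ∈ Finset.range (n + 1),
      c * β (GtTerm E (star z * c * z) b k) * GtTerm E (z * b * star z) c (n - k) := by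
  have h := momentY_rec hE hz (fun _ => b) c (Nat.succ_pos n)
  simp only [momentX_const, momentY_const, Nat.sub_zero] at h
  rw [GtTerm_eq hE, h, Finset.mul_sum, Finset.range_eq_Ico,
    ← Finset.Ico_add_one_add_one_eq_Ioc, ← Finset.sum_Ico_add']
  refine Finset.sum_congr rfl fun k _ => ?_
  rw [GtTerm_eq hE, GtTerm_eq hE]
  simp only [mul_assoc, zero_add, Nat.add_sub_cancel,
    Nat.succ_eq_add_one, Nat.add_sub_add_right]

theorem norm_mul_pow_le {R : Type*} [NormedRing R] (b y : R) (n : ℕ) :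
    ‖b * y ^ n‖ ≤ ‖b‖ * ‖y‖ ^ n := by
  induction n with
  | zero => simp
  | succ n ih =>
    rw [pow_succ, pow_succ, ← mul_assoc, ← mul_assoc]
    exact (norm_mul_le _ _).trans (by gcongr)

theorem norm_GtTerm_le {C : ℝ} (hC : ∀ a : A, ‖E a‖ ≤ C * ‖a‖) (hC0 : 0 ≤ C) (x : A) (b : B)
    {t : ℝ} (ht : ‖x * b‖ ≤ t) (n : ℕ) : ‖GtTerm E x b n‖ ≤ C * ‖b‖ * t ^ n := by
  refine (hC _).trans ?_
  rw [mul_assoc]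
  gcongr
  refine (norm_mul_pow_le _ _ _).trans ?_
  gcongr
  rfl

theorem norm_Gt_le {C : ℝ} (hC : ∀ a : A, ‖E a‖ ≤ C * ‖a‖) (hC0 : 0 ≤ C) (x : A) (b : B)
    (hx : ‖x * b‖ ≤ 1 / 2) :
    Summable (fun n => ‖GtTerm E x b n‖) ∧ ‖Gt E x b‖ ≤ 2 * C * ‖b‖ := by
  have hg : HasSum (fun n : ℕ => C * ‖b‖ * (1 / 2 : ℝ) ^ n) (C * ‖b‖ * 2) :=
    hasSum_geometric_two.mul_left _
  refine ⟨Summable.of_nonneg_of_le (fun _ => norm_nonneg _)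
    (fun n => norm_GtTerm_le hC hC0 x b hx n) hg.summable, ?_⟩
  refine (tsum_of_norm_bounded hg (fun n => norm_GtTerm_le hC hC0 x b hx n)).trans (le_of_eq ?_)
  ring

end

section

variable {A : Type*} [NormedRing A] [StarRing A] [NormedAlgebra ℂ A] [StarModule ℂ A]
  {B : StarSubalgebra ℂ A} {E : A →ₗ[ℂ] B} {α β : B →ₗ[ℂ] B} {z : A}

theorem norm_mul_mul_mul_le {R : Type*} [SeminormedRing R] (a b c d : R) :
    ‖a * b * c * d‖ ≤ ‖a‖ * ‖c‖ * (‖b‖ * ‖d‖) := by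
  calc ‖a * b * c * d‖ ≤ ‖a * b * c‖ * ‖d‖ := norm_mul_le _ _
    _ ≤ ‖a‖ * ‖b‖ * ‖c‖ * ‖d‖ := by gcongr; exact norm_mul₃_le
    _ = _ := by ring

/-- The constants of the convergence estimates: `C` bounds `E`, and `D` bounds the covariance
maps and the products `‖z‖ * ‖z*‖`. -/
theorem exists_bounds (hE : IsBanachNCProbSpace B E) (hz : IsBCircular E z α β) :
    ∃ C D : ℝ, 1 ≤ C ∧ 1 ≤ D ∧ (∀ a : A, ‖E a‖ ≤ C * ‖a‖) ∧ ‖star z‖ * ‖z‖ ≤ D ∧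
      (∀ b : B, ‖α b‖ ≤ D * ‖b‖) ∧ ∀ b : B, ‖β b‖ ≤ D * ‖b‖ := by
  obtain ⟨C₀, hC₀⟩ := hE.bounded
  set C := max C₀ 1
  set P := ‖star z‖ * ‖z‖ with hP
  have hP0 : 0 ≤ P := by positivity
  have hC1 : 1 ≤ C := le_max_right _ _
  have hC : ∀ a : A, ‖E a‖ ≤ C * ‖a‖ := fun a =>
    (hC₀ a).trans (mul_le_mul_of_nonneg_right (le_max_left _ _) (norm_nonneg _))
  have hPD : C * P ≤ C * (P + 1) := by gcongr; linarith
  have hcov : ∀ (y y' : A) (b : B), ‖y‖ * ‖y'‖ = P → ‖E (y * b * y')‖ ≤ C * (P + 1) * ‖b‖ := by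
    intro y y' b hy
    calc ‖E (y * b * y')‖ ≤ C * (‖y‖ * ‖(b : A)‖ * ‖y'‖) :=
          (hC _).trans (by gcongr; exact norm_mul₃_le)
      _ = C * P * ‖b‖ := by rw [← hy]; simp only [AddSubgroupClass.coe_norm]; ring
      _ ≤ _ := by gcongr
  -- With `P = ‖star z‖ * ‖z‖`, the number `C * (P + 1)` dominates `1`, `P` and the bound `C * P` of
  -- the covariance maps.
  refine ⟨C, C * (P + 1), hC1, by nlinarith, hC, by nlinarith, fun b => ?_, fun b => ?_⟩
  · rw [← hz.cov_star_self]
    exact hcov _ _ b rfl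
  · rw [← hz.cov_self_star]
    exact hcov _ _ b (mul_comm _ _)

theorem summable_norm_mul_map {R : Type*} [NormedRing R] [NormedAlgebra ℂ R] (T : R →L[ℂ] R)
    (b : R) {v : ℕ → R} (hv : Summable fun n => ‖v n‖) : Summable fun n => ‖b * T (v n)‖ := by
  refine Summable.of_nonneg_of_le (fun _ => norm_nonneg _) (fun n => ?_)
    (hv.mul_left (‖b‖ * ‖T‖))
  rw [mul_assoc]
  exact (norm_mul_le _ _).trans (by gcongr; exact T.le_opNorm _)

/-- The subordination equations for `z* c z` and `z b z*`, the inverses not yet taken. -/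
theorem Gt_eq_add [CompleteSpace B] (hE : IsNCProbSpace B E) (hz : IsBCircular E z α β) {D : ℝ}
    (hα : ∀ b : B, ‖α b‖ ≤ D * ‖b‖) (hβ : ∀ b : B, ‖β b‖ ≤ D * ‖b‖) (b c : B)
    (hu : Summable fun n => ‖GtTerm E (star z * c * z) b n‖)
    (hv : Summable fun n => ‖GtTerm E (z * b * star z) c n‖) :
    Gt E (star z * c * z) b =
        b + b * α (Gt E (z * b * star z) c) * Gt E (star z * c * z) b ∧
      Gt E (z * b * star z) c =
        c + c * β (Gt E (star z * c * z) b) * Gt E (z * b * star z) c := by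
  let αL : B →L[ℂ] B := α.mkContinuous D hα
  let βL : B →L[ℂ] B := β.mkContinuous D hβ
  have hmap : ∀ (T : B →L[ℂ] B) (d : B) {v : ℕ → B}, (Summable fun n => ‖v n‖) →
      ∑' n, d * T (v n) = d * T (∑' n, v n) := by
    intro T d v hv
    have hT : Summable fun n => T (v n) := T.summable hv.of_norm
    rw [hT.tsum_mul_left, T.map_tsum hv.of_norm]
  constructor
  · have h := tsum_eq_add_mul_tsum hu (summable_norm_mul_map αL b hv)
      (GtTerm_star_mul_mul_succ hE hz b c)
    rwa [hmap αL b hv, GtTerm_zero hE] at h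
  · have h := tsum_eq_add_mul_tsum hv (summable_norm_mul_map βL c hu)
      (GtTerm_mul_mul_star_succ hE hz b c)
    rwa [hmap βL c hu, GtTerm_zero hE] at h

theorem eq_inverse_mul_of_eq_add {R : Type*} [Ring R] {b t g : R} (ht : IsUnit (1 - t))
    (h : g = b + t * g) : g = Ring.inverse (1 - t) * b := by
  have : (1 - t) * g = b := by
    rw [sub_mul, one_mul]
    exact sub_eq_of_eq_add h
  rw [← this, Ring.inverse_mul_cancel_left _ _ ht]

end

end BFree

end

/-! ### Assembly -/

open BFree in
theorem mainTheorem6 {A : Type*} [NormedRing A] [StarRing A] [NormedAlgebra ℂ A]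
    [StarModule ℂ A] [CompleteSpace A] (B : StarSubalgebra ℂ A) (E : A →ₗ[ℂ] B)
    (hE : BFree.IsBanachNCProbSpace B E) (α β : B →ₗ[ℂ] B) (z : A)
    (hz : BFree.IsBCircular E z α β) :
    (∃ δ : ℝ, 0 < δ ∧ ∀ b c : B, ‖b‖ * ‖c‖ < δ →
      -- the two series converge
      Summable (BFree.GtTerm E (star z * c * z) b) ∧
      Summable (BFree.GtTerm E (z * b * star z) c) ∧
      -- the first formula
      IsUnit (1 - b * α (BFree.Gt E (z * b * star z) c)) ∧
      BFree.Gt E (star z * c * z) b =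
        Ring.inverse (1 - b * α (BFree.Gt E (z * b * star z) c)) * b ∧
      -- the second formula
      IsUnit (1 - c * β (BFree.Gt E (star z * c * z) b)) ∧
      IsUnit (1 - b * α (Ring.inverse (1 - c * β (BFree.Gt E (star z * c * z) b)) * c)) ∧
      BFree.Gt E (star z * c * z) b =
        Ring.inverse
          (1 - b * α (Ring.inverse (1 - c * β (BFree.Gt E (star z * c * z) b)) * c)) * b ∧
      -- the R-transform as the series of free cumulants
      IsUnit (1 - c * β b) ∧
      HasSum (BFree.RTerm E (star z * c * z) b) (α (Ring.inverse (1 - c * β b) * c))) ∧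
    -- the R-transform by functional inversion
    ∀ c : B, BFree.IsRTransform E (star z * c * z)
      (fun b : B => α (Ring.inverse (1 - c * β b) * c)) := by
  have : CompleteSpace B := hE.isClosed.completeSpace_coe
  obtain ⟨C, D, hC1, hD1, hC, hP, hα, hβ⟩ := exists_bounds hE hz
  have hE' := hE.toIsNCProbSpace
  -- Below this threshold `x b` and its counterpart have norm at most `1 / 2`, so the transforms are
  -- bounded by `2 * C * ‖b‖` and `2 * C * ‖c‖`. The elements subtracted from `1` in the first
  -- formula and in the equation for the second transform then have norm at most `2 * C * D * ‖b‖ *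
  -- ‖c‖ < 1`.
  set δ : ℝ := 1 / (2 * C * D) with hδ
  have hδ0 : 0 < δ := by positivity
  have hsmall : ∀ t : ℝ, 0 ≤ t → t < δ → 2 * C * D * t < 1 ∧ D * t ≤ 1 / 2 := by
    intro t ht0 ht
    have h1 : 2 * C * D * t < 1 := by
      rwa [hδ, lt_div_iff₀ (by positivity), mul_comm] at ht
    refine ⟨h1, ?_⟩
    have : 1 * (D * t) ≤ C * (D * t) := by gcongr
    linarith
  have hx : ∀ b c : B, ‖b‖ * ‖c‖ < δ → ‖star z * c * z * b‖ ≤ 1 / 2 := by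
    intro b c h
    have := (hsmall _ (by positivity) h).2
    refine (norm_mul_mul_mul_le _ _ _ _).trans (le_trans ?_ this)
    rw [mul_comm ‖b‖]
    exact mul_le_mul_of_nonneg_right hP (by positivity)
  have hy : ∀ b c : B, ‖b‖ * ‖c‖ < δ → ‖z * b * star z * c‖ ≤ 1 / 2 := by
    intro b c h
    have := (hsmall _ (by positivity) h).2
    refine (norm_mul_mul_mul_le _ _ _ _).trans (le_trans ?_ this)
    rw [mul_comm ‖z‖]
    exact mul_le_mul_of_nonneg_right hP (by positivity)
  have hGx := fun b c h => norm_Gt_le hC (by positivity) _ b (hx b c h)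
  have hGy := fun b c h => norm_Gt_le hC (by positivity) _ c (hy b c h)
  have hunit : ∀ (T : B →ₗ[ℂ] B) (b c g : B), (∀ b, ‖T b‖ ≤ D * ‖b‖) → ‖b‖ * ‖c‖ < δ →
      ‖g‖ ≤ 2 * C * ‖c‖ → IsUnit (1 - b * T g) := by
    intro T b c g hT h hg
    refine isUnit_one_sub_of_norm_lt_one (lt_of_le_of_lt ?_ (hsmall _ (by positivity) h).1)
    calc ‖b * T g‖ ≤ ‖b‖ * (D * ‖g‖) := (norm_mul_le _ _).trans (by gcongr; exact hT _)
      _ ≤ ‖b‖ * (D * (2 * C * ‖c‖)) := by gcongr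
      _ = _ := by ring
  have hmain : ∀ b c : B, ‖b‖ * ‖c‖ < δ →
      IsUnit (1 - b * α (Gt E (z * b * star z) c)) ∧
      Gt E (star z * c * z) b =
        b + b * α (Gt E (z * b * star z) c) * Gt E (star z * c * z) b ∧
      IsUnit (1 - c * β (Gt E (star z * c * z) b)) ∧
      Gt E (z * b * star z) c = Ring.inverse (1 - c * β (Gt E (star z * c * z) b)) * c := by
    intro b c h
    obtain ⟨h1, h2⟩ := Gt_eq_add hE' hz hα hβ b c (hGx b c h).1 (hGy b c h).1
    have hub := hunit α b c _ hα h (hGy b c h).2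
    have huc := hunit β c b _ hβ (by rwa [mul_comm]) (hGx b c h).2
    exact ⟨hub, h1, huc, eq_inverse_mul_of_eq_add huc h2⟩
  refine ⟨⟨δ, hδ0, fun b c h => ?_⟩, fun c => ?_⟩
  · obtain ⟨hub, h1, huc, h2⟩ := hmain b c h
    have h3 := eq_inverse_mul_of_eq_add hub h1
    have hlt : ‖c * β b‖ < 1 := by
      have := (hsmall _ (by positivity) h).2
      have : ‖c * β b‖ ≤ D * (‖b‖ * ‖c‖) :=
        (norm_mul_le _ _).trans ((mul_le_mul_of_nonneg_left (hβ b) (norm_nonneg c)).trans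
          (le_of_eq (by ring)))
      linarith
    refine ⟨(hGx b c h).1.of_norm, (hGy b c h).1.of_norm, hub, h3, huc, ?_, ?_,
      isUnit_one_sub_of_norm_lt_one hlt, ?_⟩
    · rwa [← h2]
    · rwa [← h2]
    -- The cumulant series is the image under the continuous map `α` of the geometric series in `c *
    -- β b`, multiplied by `c`.
    · have hs := (hasSum_geom_series_inverse _ hlt).mul_right c
      have hs' := (α.mkContinuous D hα).hasSum hs
      have e : RTerm E (star z * c * z) b =
          fun n => α ((c * β b) ^ n * c) := funext fun n => freeCumulant_star_mul_mul hE' hz b c n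
      rw [e]
      exact hs'
  · have hev : ∀ᶠ b : B in 𝓝 0, ‖b‖ * ‖c‖ < δ := by
      have : Tendsto (fun b : B => ‖b‖ * ‖c‖) (𝓝 0) (𝓝 0) := by
        simpa using (tendsto_norm_zero (E := B)).mul_const ‖c‖
      exact this.eventually (gt_mem_nhds hδ0)
    have hR : AnalyticAt ℂ (fun b : B => α (Ring.inverse (1 - c * β b) * c)) 0 := by
      have hβa : AnalyticAt ℂ (fun b : B => 1 - c * β b) 0 :=
        analyticAt_const.sub (analyticAt_const.mul ((β.mkContinuous D hβ).analyticAt 0))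
      have hinv : AnalyticAt ℂ (fun b : B => Ring.inverse (1 - c * β b)) 0 := by
        refine AnalyticAt.comp (g := Ring.inverse) ?_ hβa
        rw [map_zero, mul_zero, sub_zero]
        exact analyticAt_inverse (1 : Bˣ)
      exact ((α.mkContinuous D hα).analyticAt _).comp (hinv.mul analyticAt_const)
    refine ⟨hR, exists_analytic_inverse _ _ hR ?_ ?_⟩
    -- For fixed `c` the bound `2 * C * ‖b‖` forces the transform to tend to `0` with `b`.
    · refine squeeze_zero_norm' (hev.mono fun b h => (hGx b c h).2) ?_
      simpa using (tendsto_norm_zero (E := B)).const_mul (2 * C)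
    -- Substituting the solved equation `h2` for the transform of `z b z*` turns `h1` into `G = b +
    -- b R(G) G`.
    · filter_upwards [hev] with b h
      obtain ⟨_, h1, _, h2⟩ := hmain b c h
      rwa [← h2]
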